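/- Let $V$ be a finite-dimensional real vector space with a symmetric bilinear form $B$, and let $\Delta$ be a basis of $V$ such that $B(\alpha,\alpha)=1$ for all $\alpha\in\Delta$ and $B(\alpha,\beta)\in(-\infty,-1]\cup\{-\cos(\pi/k) : k\in\mathbb Z_{\ge 2}\}$ for all distinct $\alpha,\beta\in\Delta$. Let $W$ be the group generated by the reflections $s_\alpha(v)=v-2B(\alpha,v)\,\alpha$ for $\alpha\in\Delta$, let $\Phi=W(\Delta)$ be the associated root system, and let $\Phi^+$ be the set of roots that are linear combinations of elements of $\Delta$ with nonnegative coefficients. Assume that $\Phi$ is infinite. For $v\in V$ let $|v|_1$ be the sum of the coordinates of $v$ in the basis $\Delta$, put $V_1=\{v : |v|_1=1\}$, and write $\widehat v=v/|v|_1$ when $|v|_1\neq 0$ (which holds for every root). Let $\widehat Q=\{v\in V_1 : B(v,v)=0\}$, let $\widehat\Phi=\{\widehat\rho : \rho\in\Phi\}$ be the set of normalized roots, and let $E$ be the set of limit roots, i.e. of accumulation points of $\widehat\Phi$. For distinct points $x,y$ let $L(x,y)$ denote the affine line through $x$ and $y$, and put $$E_2^\circ=\bigcup_{\alpha\in\Delta,\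 \rho\in\Phi^+,\ \rho\ne\alpha} L(\alpha,\widehat\rho)\cap\widehat Q .$$ Then $E_2^\circ\subseteq E$, and $E_2^\circ$ is dense in $E$, that is, $E\subseteq\overline{E_2^\circ}$. -/

import Mathlib

open Set Topology

namespace BasedRoot

section Algebra

variable {V : Type*} [AddCommGroup V] [Module ℝ V]

/-- A simple system in `(V, B)`: a finite, positively independent set of vectors of `B`-square `1`
whose mutual products lie in `(-∞, -1] ∪ {-cos (π / k) | k ≥ 2}`. -/
structure IsSimpleSystem (B : LinearMap.BilinForm ℝ V) (Δ : Set V) : Prop where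
  finite : Δ.Finite
  posIndep : ∀ c : V →₀ ℝ, (c.support : Set V) ⊆ Δ → (∀ α, 0 ≤ c α) →
    (c.sum fun α t => t • α) = 0 → c = 0
  offDiag : ∀ α ∈ Δ, ∀ β ∈ Δ, α ≠ β →
    B α β ≤ -1 ∨ ∃ k : ℕ, 2 ≤ k ∧ B α β = -Real.cos (Real.pi / k)
  diag : ∀ α ∈ Δ, B α α = 1

/-- The linear map `v ↦ v - 2 (B(α, v) / B(α, α)) α`. -/
noncomputable def reflectionMap (B : LinearMap.BilinForm ℝ V) (α : V) : V →ₗ[ℝ] V :=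
  LinearMap.id - (2 * (B α α)⁻¹) • (B α).smulRight α

theorem reflectionMap_apply (B : LinearMap.BilinForm ℝ V) (α v : V) :
    reflectionMap B α v = v - (2 * (B α v / B α α)) • α := by
  simp only [reflectionMap, LinearMap.sub_apply, LinearMap.id_apply, LinearMap.smul_apply,
    LinearMap.smulRight_apply, smul_smul]
  congr 2
  ring

theorem reflectionMap_involutive (B : LinearMap.BilinForm ℝ V) (α : V) (h : B α α ≠ 0) :
    Function.Involutive (reflectionMap B α) := by
  intro v
  have h2 : 2 * (B α α / B α α) = 2 := by rw [div_self h, mul_one]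
  simp only [reflectionMap_apply, map_sub, map_smul, h2]
  module

/-- The `B`-reflection `s_α`, for `B(α, α) ≠ 0`. -/
noncomputable def reflection (B : LinearMap.BilinForm ℝ V) (α : V) (h : B α α ≠ 0) : V ≃ₗ[ℝ] V :=
  LinearEquiv.ofInvolutive (reflectionMap B α) (reflectionMap_involutive B α h)

/-- The group `W` generated by the `B`-reflections in the elements of `Δ`. -/
def weylGroup (B : LinearMap.BilinForm ℝ V) (Δ : Set V) : Subgroup (V ≃ₗ[ℝ] V) :=
  Subgroup.closure {g | ∃ α ∈ Δ, ∃ h : B α α ≠ 0, g = reflection B α h}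

/-- The root system `Φ`, the orbit of `Δ` under `W`. -/
def roots (B : LinearMap.BilinForm ℝ V) (Δ : Set V) : Set V :=
  {ρ | ∃ w ∈ weylGroup B Δ, ∃ α ∈ Δ, ρ = w α}

/-- The positive roots `Φ⁺ = Φ ∩ cone(Δ)`. -/
def posRoots (B : LinearMap.BilinForm ℝ V) (Δ : Set V) : Set V :=
  roots B Δ ∩ (PointedCone.hull ℝ Δ : Set V)

/-- The isotropic cone `Q`. -/
def isotropicCone (B : LinearMap.BilinForm ℝ V) : Set V := {v | B v v = 0}

variable {ι : Type*} [Fintype ι]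

/-- The sum `|v|₁` of the coordinates of `v` in the basis of simple roots. -/
noncomputable def coordSum (b : Module.Basis ι ℝ V) (v : V) : ℝ := ∑ i, b.repr v i

/-- The affine hyperplane `V₁`. -/
def affHyperplane (b : Module.Basis ι ℝ V) : Set V := {v | coordSum b v = 1}

/-- The normalization `v̂ = v / |v|₁` (meaningful when `|v|₁ ≠ 0`). -/
noncomputable def normalize (b : Module.Basis ι ℝ V) (v : V) : V := (coordSum b v)⁻¹ • v

/-- The normalized isotropic cone `Q̂ = Q ∩ V₁`. -/
def normIsotropicCone (B : LinearMap.BilinForm ℝ V) (b : Module.Basis ι ℝ V) : Set V :=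
  isotropicCone B ∩ affHyperplane b

/-- The normalized roots `Φ̂`. -/
def normRoots (B : LinearMap.BilinForm ℝ V) (b : Module.Basis ι ℝ V) : Set V :=
  normalize b '' roots B (range b)

/-- The set `E₂°`: the points of `Q̂` on a line `L(α, ρ̂)` through a simple root `α` and a
normalized positive root `ρ̂`. For `ρ = α` the affine span is the point `α`, which is not
isotropic, so this degenerate case contributes nothing. -/
def simpleDihedralLimitRoots (B : LinearMap.BilinForm ℝ V) (b : Module.Basis ι ℝ V) : Set V :=
  ⋃ α ∈ range b, ⋃ ρ ∈ posRoots B (range b),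
    (affineSpan ℝ {α, normalize b ρ} : Set V) ∩ normIsotropicCone B b

end Algebra

section Topology

variable {V : Type*} [NormedAddCommGroup V] [NormedSpace ℝ V] {ι : Type*} [Fintype ι]

/-- The set `E` of limit roots: the accumulation points of the normalized roots. -/
def limitRoots (B : LinearMap.BilinForm ℝ V) (b : Module.Basis ι ℝ V) : Set V :=
  derivedSet (normRoots B b)

end Topology

end BasedRoot

/-! Induction on word length shows that every root is nonnegative or nonpositive in the basis Δ
(`coord_nonneg_of_wordLength_le`), which in turn shows that the roots do not accumulate
(`not_accPt_roots`). So the coordinate sums of distinct positive roots tend to infinity, and since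
B(ρ̂, ρ̂) = |ρ|₁⁻², limit roots are isotropic.

The inclusion E₂° ⊆ E is a rank two computation. Alternating reflections in two roots produce roots
whose coefficient ratios converge to that of an isotropic vector of the plane
(`isotropic_mem_limitRoots`).

For density, let η be a limit root. If B(α, η) ≠ 0 for some simple α, the line through α and η
crosses Q transversally at η, so L(α, ρ̂) still meets Q near η when ρ̂ is close to η
(`mem_closure_of_bilin_ne_zero`).

Otherwise η lies in the radical of B and its support is an irreducible affine component, on which B
is positive semidefinite with kernel ℝη (`isAffineRadical_of_limit`). Then η itself belongs to E₂°.
Products of two roots of the component take finitely many values (`exists_finite_bilin_values`), so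
among its infinitely many positive roots two differ by a nonzero multiple cη. An element of W, which
fixes η, moves one of them to a simple root α. Thus α - cη is a root, and η lies on the line through
α and its normalization. No classification of affine types is needed. -/

namespace BasedRoot

/-! ### Word length in a group generated by involutions. -/

section WordLength

variable {ι G : Type*} [Group G]

/-- The length of `g` as a word in the family `s`. -/
noncomputable def wordLength (s : ι → G) (g : G) : ℕ :=
  sInf {n | ∃ l : List ι, l.length = n ∧ (l.map s).prod = g}

theorem wordLength_prod_le (s : ι → G) (l : List ι) :
    wordLength s (l.map s).prod ≤ l.length :=
  Nat.sInf_le ⟨l, rfl, rfl⟩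

theorem exists_word {s : ι → G} (hs : ∀ i, s i * s i = 1) {g : G}
    (hg : g ∈ Subgroup.closure (range s)) : ∃ l : List ι, (l.map s).prod = g := by
  induction hg using Subgroup.closure_induction with
  | mem x hx => obtain ⟨i, rfl⟩ := hx; exact ⟨[i], by simp⟩
  | one => exact ⟨[], by simp⟩
  | mul x y _ _ hx hy =>
    obtain ⟨l, rfl⟩ := hx
    obtain ⟨l', rfl⟩ := hy
    exact ⟨l ++ l', by simp⟩
  | inv x _ hx =>
    obtain ⟨l, rfl⟩ := hx
    refine ⟨l.reverse, ?_⟩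
    rw [List.prod_inv_reverse, List.map_map, List.map_reverse]
    congr 2
    refine List.map_congr_left fun i _ => ?_
    exact eq_inv_of_mul_eq_one_left (hs i)

theorem exists_reduced_word {s : ι → G} (hs : ∀ i, s i * s i = 1) {g : G}
    (hg : g ∈ Subgroup.closure (range s)) :
    ∃ l : List ι, l.length = wordLength s g ∧ (l.map s).prod = g := by
  obtain ⟨l, hl⟩ := exists_word hs hg
  exact Nat.sInf_mem (s := {n | ∃ l : List ι, l.length = n ∧ (l.map s).prod = g}) ⟨_, l, rfl, hl⟩

theorem wordLength_mul_prod_le {s : ι → G} (hs : ∀ i, s i * s i = 1) {g : G}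
    (hg : g ∈ Subgroup.closure (range s)) (l : List ι) :
    wordLength s (g * (l.map s).prod) ≤ wordLength s g + l.length := by
  obtain ⟨l', hl', rfl⟩ := exists_reduced_word hs hg
  rw [← hl']
  simpa using wordLength_prod_le s (l' ++ l)

theorem wordLength_mul_le {s : ι → G} (hs : ∀ i, s i * s i = 1) {g : G}
    (hg : g ∈ Subgroup.closure (range s)) (i : ι) :
    wordLength s (g * s i) ≤ wordLength s g + 1 := by
  simpa using wordLength_mul_prod_le hs hg [i]

theorem mul_generator_mem {s : ι → G} {g : G} (hg : g ∈ Subgroup.closure (range s)) (i : ι) :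
    g * s i ∈ Subgroup.closure (range s) :=
  mul_mem hg (Subgroup.subset_closure ⟨i, rfl⟩)

theorem wordLength_le_mul {s : ι → G} (hs : ∀ i, s i * s i = 1) {g : G}
    (hg : g ∈ Subgroup.closure (range s)) (i : ι) :
    wordLength s g ≤ wordLength s (g * s i) + 1 := by
  simpa [mul_assoc, hs] using wordLength_mul_le hs (mul_generator_mem hg i) i

theorem exists_wordLength_mul_lt {s : ι → G} (hs : ∀ i, s i * s i = 1) {g : G}
    (hg : g ∈ Subgroup.closure (range s)) (h1 : g ≠ 1) :
    ∃ i, wordLength s (g * s i) < wordLength s g := by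
  obtain ⟨l, hl, hlg⟩ := exists_reduced_word hs hg
  rcases List.eq_nil_or_concat l with rfl | ⟨l', i, rfl⟩
  · exact absurd (by simpa using hlg.symm) h1
  · refine ⟨i, ?_⟩
    have h2 : g * s i = (l'.map s).prod := by
      rw [← hlg]; simp [mul_assoc, hs]
    rw [h2, ← hl]
    refine (wordLength_prod_le s l').trans_lt ?_
    simp

end WordLength

/-! ### Orbits of a rank two reflection group. -/

section Dihedral

/-- The sequence `0, 1, 2a, …`, the values at `a` of the Chebyshev polynomials of the second
kind. -/
def dihedralSeq (a : ℝ) : ℕ → ℝ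
  | 0 => 0
  | 1 => 1
  | n + 2 => 2 * a * dihedralSeq a (n + 1) - dihedralSeq a n

theorem dihedralSeq_mul_sin (θ : ℝ) (n : ℕ) :
    dihedralSeq (Real.cos θ) n * Real.sin θ = Real.sin (n * θ) := by
  induction n using Nat.twoStepInduction with
  | zero => simp [dihedralSeq]
  | one => simp [dihedralSeq]
  | more n h0 h1 =>
    rw [dihedralSeq, sub_mul, h0, mul_assoc, h1]
    push_cast
    have e1 : ((n : ℝ) + 2) * θ = (n + 1) * θ + θ := by ring
    have e2 : (n : ℝ) * θ = (n + 1) * θ - θ := by ring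
    rw [e1, e2, Real.sin_add, Real.sin_sub]
    ring

/-- For a ≥ 1 the increments never decrease, and the first one is 1. -/
theorem natCast_le_dihedralSeq {a : ℝ} (ha : 1 ≤ a) (n : ℕ) : (n : ℝ) ≤ dihedralSeq a n := by
  suffices h : (n : ℝ) ≤ dihedralSeq a n ∧ dihedralSeq a n + 1 ≤ dihedralSeq a (n + 1) from h.1
  induction n with
  | zero => simp [dihedralSeq]
  | succ n ih =>
    obtain ⟨h0, h1⟩ := ih
    have hn : (0 : ℝ) ≤ n := n.cast_nonneg
    rw [dihedralSeq]
    push_cast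
    constructor
    · linarith
    · nlinarith

variable {V : Type*} [AddCommGroup V] [Module ℝ V]

/-- The product of `n` alternating factors `x`, `y`, the rightmost of which is `y`. -/
def alternatingProd {G : Type*} [Monoid G] (x y : G) : ℕ → G
  | 0 => 1
  | n + 1 => (if Even n then y else x) * alternatingProd x y n

/-- Each further reflection alters only the older of the two coefficients, by the three-term
recurrence; parity records which of α, β carries it. -/
theorem alternatingProd_apply {B : LinearMap.BilinForm ℝ V} (hB : B.IsSymm) {α β : V}
    {x y : V ≃ₗ[ℝ] V}
    (hx : ∀ v, x v = v - (2 * B α v) • α) (hy : ∀ v, y v = v - (2 * B β v) • β)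
    (hα : B α α = 1) (hβ : B β β = 1) (n : ℕ) :
    alternatingProd x y n α =
      dihedralSeq (-B α β) (n + 1) • (if Even n then α else β) +
      dihedralSeq (-B α β) n • (if Even n then β else α) := by
  have hs : B β α = B α β := hB.eq β α
  induction n with
  | zero => simp [alternatingProd, dihedralSeq]
  | succ n ih =>
    rw [alternatingProd, LinearEquiv.mul_apply, ih]
    by_cases h : Even n
    · have h' : ¬ Even (n + 1) := by simpa [Nat.even_add_one] using h
      simp only [h, h', if_true, if_false, hy, map_add, map_smul, smul_eq_mul, hβ, hs, dihedralSeq]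
      module
    · have h' : Even (n + 1) := by simpa [Nat.even_add_one] using h
      simp only [h, h', if_true, if_false, hx, map_add, map_smul, smul_eq_mul, hα, dihedralSeq]
      module

end Dihedral

/-! ### Simple reflections and the sign of roots. -/

section Simple

variable {V : Type*} [AddCommGroup V] [Module ℝ V] {ι : Type*}
  {b : Module.Basis ι ℝ V} {B : LinearMap.BilinForm ℝ V}

theorem IsSimpleSystem.basis_diag (hΔ : IsSimpleSystem B (range b)) (i : ι) : B (b i) (b i) = 1 :=
  hΔ.diag _ ⟨i, rfl⟩

theorem IsSimpleSystem.basis_offDiag (hΔ : IsSimpleSystem B (range b)) {i j : ι} (h : i ≠ j) :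
    B (b i) (b j) ≤ -1 ∨ ∃ k : ℕ, 2 ≤ k ∧ B (b i) (b j) = -Real.cos (Real.pi / k) :=
  hΔ.offDiag _ ⟨i, rfl⟩ _ ⟨j, rfl⟩ fun e => h (b.injective e)

theorem IsSimpleSystem.basis_offDiag_nonpos (hΔ : IsSimpleSystem B (range b)) {i j : ι}
    (h : i ≠ j) : B (b i) (b j) ≤ 0 := by
  rcases hΔ.basis_offDiag h with h | ⟨k, hk, h⟩
  · linarith
  · rw [h, neg_nonpos]
    have hk' : (2 : ℝ) ≤ k := by exact_mod_cast hk
    refine Real.cos_nonneg_of_mem_Icc ⟨?_, ?_⟩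
    · have : 0 ≤ Real.pi / k := by positivity
      linarith [Real.pi_pos]
    · exact div_le_div_of_nonneg_left Real.pi_pos.le (by norm_num) hk'

theorem reflection_apply_of_unit {α : V} (h : B α α = 1) (h' : B α α ≠ 0) (v : V) :
    reflection B α h' v = v - (2 * B α v) • α := by
  change reflectionMap B α v = _
  rw [reflectionMap_apply, h, div_one]

/-- The reflection in the `i`-th simple root. -/
noncomputable def simpleReflection (hΔ : IsSimpleSystem B (range b)) (i : ι) : V ≃ₗ[ℝ] V :=
  reflection B (b i) (by rw [hΔ.basis_diag]; exact one_ne_zero)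

variable (hΔ : IsSimpleSystem B (range b))

theorem simpleReflection_apply (i : ι) (v : V) :
    simpleReflection hΔ i v = v - (2 * B (b i) v) • b i :=
  reflection_apply_of_unit (hΔ.basis_diag i) _ v

theorem simpleReflection_self (i : ι) : simpleReflection hΔ i (b i) = -b i := by
  rw [simpleReflection_apply, hΔ.basis_diag]; module

theorem simpleReflection_mul_self (i : ι) : simpleReflection hΔ i * simpleReflection hΔ i = 1 := by
  ext v
  exact reflectionMap_involutive B (b i) (by rw [hΔ.basis_diag]; exact one_ne_zero) v

theorem weylGroup_eq_closure :
    weylGroup B (range b) = Subgroup.closure (range (simpleReflection hΔ)) := by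
  rw [weylGroup]
  congr 1
  ext g
  constructor
  · rintro ⟨_, ⟨i, rfl⟩, h, rfl⟩; exact ⟨i, rfl⟩
  · rintro ⟨i, rfl⟩; exact ⟨b i, ⟨i, rfl⟩, _, rfl⟩

theorem simpleReflection_mem (i : ι) : simpleReflection hΔ i ∈ weylGroup B (range b) := by
  rw [weylGroup_eq_closure hΔ]
  exact Subgroup.subset_closure ⟨i, rfl⟩

/-- The two kinds of admissible product correspond to an infinite dihedral group and to a finite
one, where the sequence is sin(nπ/m) / sin(π/m). This is where the restriction to -cos(π/k) enters.
-/
theorem dihedralSeq_nonneg_or (hΔ : IsSimpleSystem B (range b)) {i j : ι} (hij : i ≠ j) :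
    (∀ n, 0 ≤ dihedralSeq (-B (b i) (b j)) n) ∨
    ∃ m, 1 ≤ m ∧ (∀ n ≤ m, 0 ≤ dihedralSeq (-B (b i) (b j)) n) ∧
      dihedralSeq (-B (b i) (b j)) m = 0 ∧ dihedralSeq (-B (b i) (b j)) (m + 1) = -1 := by
  rcases hΔ.basis_offDiag hij with h | ⟨m, hm, h⟩
  · exact .inl fun n => n.cast_nonneg.trans (natCast_le_dihedralSeq (by linarith) n)
  · right
    rw [h, neg_neg]
    have hm' : (2 : ℝ) ≤ m := by exact_mod_cast hm
    have hm0 : (m : ℝ) ≠ 0 := by positivity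
    have hpos : 0 < Real.sin (Real.pi / m) := by
      refine Real.sin_pos_of_pos_of_lt_pi (by have := Real.pi_pos; positivity) ?_
      exact div_lt_self Real.pi_pos (by linarith)
    have key := dihedralSeq_mul_sin (Real.pi / m)
    refine ⟨m, by omega, fun n hn => ?_, ?_, ?_⟩
    · refine nonneg_of_mul_nonneg_left ?_ hpos
      rw [key]
      refine Real.sin_nonneg_of_nonneg_of_le_pi (by have := Real.pi_pos; positivity) ?_
      rw [← mul_div_assoc, div_le_iff₀ (by positivity), mul_comm]
      exact mul_le_mul_of_nonneg_left (by exact_mod_cast hn) Real.pi_pos.le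
    · refine (mul_eq_zero.1 ((key m).trans ?_)).resolve_right hpos.ne'
      rw [mul_div_cancel₀ _ hm0, Real.sin_pi]
    · refine mul_right_cancel₀ hpos.ne' ((key (m + 1)).trans ?_)
      push_cast
      rw [add_mul, mul_div_cancel₀ _ hm0, one_mul, add_comm, Real.sin_add_pi]
      ring

theorem mul_inv_alternatingProd {G : Type*} [Group G] {x y : G} (hx : x * x = 1) (hy : y * y = 1)
    (g : G) (n : ℕ) : g * (alternatingProd x y (n + 1))⁻¹ =
      g * (alternatingProd x y n)⁻¹ * (if Even n then y else x) := by
  have hx' : x⁻¹ = x := inv_eq_of_mul_eq_one_left hx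
  have hy' : y⁻¹ = y := inv_eq_of_mul_eq_one_left hy
  rw [alternatingProd, mul_inv_rev, mul_assoc]
  split_ifs
  · rw [hy']
  · rw [hx']

theorem alternatingProd_eq_prod {κ G : Type*} [Group G] (s : κ → G) (i j : κ) (n : ℕ) :
    ∃ l : List κ, l.length = n ∧ (l.map s).prod = alternatingProd (s i) (s j) n := by
  induction n with
  | zero => exact ⟨[], rfl, rfl⟩
  | succ n ih =>
    obtain ⟨l, hl, h⟩ := ih
    refine ⟨(if Even n then j else i) :: l, by simp [hl], ?_⟩
    rw [List.map_cons, List.prod_cons, h, alternatingProd, apply_ite s]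

theorem alternatingProd_mem {κ G : Type*} [Group G] (s : κ → G) (i j : κ) (n : ℕ) :
    alternatingProd (s i) (s j) n ∈ Subgroup.closure (range s) := by
  obtain ⟨l, -, h⟩ := alternatingProd_eq_prod s i j n
  rw [← h]
  refine list_prod_mem fun x hx => ?_
  obtain ⟨i, -, rfl⟩ := List.mem_map.1 hx
  exact Subgroup.subset_closure ⟨i, rfl⟩

theorem bilin_simpleReflection (hB : B.IsSymm) (i : ι) (u v : V) :
    B (simpleReflection hΔ i u) (simpleReflection hΔ i v) = B u v := by
  have hd := hΔ.basis_diag i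
  have hs : B u (b i) = B (b i) u := hB.eq _ _
  simp only [simpleReflection_apply, map_sub, map_smul, LinearMap.sub_apply, LinearMap.smul_apply,
    smul_eq_mul, hd, hs]
  ring

theorem weylGroup_induction {p : (V ≃ₗ[ℝ] V) → Prop} (h1 : p 1)
    (hmul : ∀ i w, p w → p (simpleReflection hΔ i * w)) {w : V ≃ₗ[ℝ] V}
    (hw : w ∈ weylGroup B (range b)) : p w := by
  rw [weylGroup_eq_closure hΔ] at hw
  obtain ⟨l, rfl⟩ := exists_word (simpleReflection_mul_self hΔ) hw
  clear hw
  induction l with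
  | nil => simpa using h1
  | cons i l ih => simpa using hmul i _ ih

theorem bilin_weylGroup (hΔ : IsSimpleSystem B (range b)) (hB : B.IsSymm)
    {w : V ≃ₗ[ℝ] V} (hw : w ∈ weylGroup B (range b))
    (u v : V) : B (w u) (w v) = B u v := by
  refine weylGroup_induction hΔ (p := fun w => B (w u) (w v) = B u v) (by simp) ?_ hw
  intro i w h
  rw [LinearEquiv.mul_apply, LinearEquiv.mul_apply, bilin_simpleReflection hΔ hB, h]

/-- Factor w = v a, with a in the dihedral group of s_i and a shortening s_j, stripping letters as
long as the length drops. Then neither s_i nor s_j shortens v, so induction applies to v, and a(α_i)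
is a nonnegative combination of α_i and α_j. -/
theorem coord_nonneg_of_wordLength_le (hB : B.IsSymm) {w : V ≃ₗ[ℝ] V}
    (hw : w ∈ weylGroup B (range b)) {i : ι}
    (h : wordLength (simpleReflection hΔ) w ≤
      wordLength (simpleReflection hΔ) (w * simpleReflection hΔ i)) (k : ι) :
    0 ≤ b.repr (w (b i)) k := by
  set s := simpleReflection hΔ with hsdef
  have hs : ∀ i, s i * s i = 1 := simpleReflection_mul_self hΔ
  rw [weylGroup_eq_closure hΔ] at hw
  induction hn : wordLength s w using Nat.strong_induction_on generalizing w i k with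
  | _ N ih =>
  subst hn
  by_cases h1 : w = 1
  · subst h1
    classical
    simp [Finsupp.single_apply]
    split_ifs <;> norm_num
  obtain ⟨j, hj⟩ := exists_wordLength_mul_lt hs hw h1
  have hij : i ≠ j := by rintro rfl; omega
  set A := alternatingProd (s i) (s j) with hA
  have hAm : ∀ n, w * (A n)⁻¹ ∈ Subgroup.closure (range s) := fun n =>
    mul_mem hw (inv_mem (alternatingProd_mem s i j n))
  have hstep : ∀ n, w * (A (n + 1))⁻¹ = w * (A n)⁻¹ * s (if Even n then j else i) := fun n => by
    rw [hA, mul_inv_alternatingProd (hs i) (hs j), apply_ite s]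
  -- Stripping cannot remove more letters than w has. The first failure occurs at some k' + 2, since
  -- stripping s j succeeds.
  have hex : ∃ n, ¬ wordLength s (w * (A n)⁻¹) + n = wordLength s w :=
    ⟨wordLength s w + 1, by omega⟩
  classical
  obtain ⟨k', hk'⟩ : ∃ k', Nat.find hex = k' + 2 := by
    have h0 : Nat.find hex ≠ 0 := fun h0 => by
      have := Nat.find_spec hex
      rw [h0] at this
      simp [hA, alternatingProd] at this
    have h1 : Nat.find hex ≠ 1 := fun h0 => by
      have h2 := Nat.find_spec hex
      have h3 := wordLength_le_mul hs hw j
      rw [h0] at h2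
      have h4 : w * (A 1)⁻¹ = w * s j := by simpa [hA, alternatingProd] using hstep 0
      rw [h4] at h2
      omega
    exact ⟨Nat.find hex - 2, by omega⟩
  have hlt : ∀ n ≤ k' + 1, wordLength s (w * (A n)⁻¹) + n = wordLength s w := fun n hn =>
    not_not.1 (Nat.find_min hex (m := n) (by omega))
  have hbad : ¬ wordLength s (w * (A (k' + 2))⁻¹) + (k' + 2) = wordLength s w := by
    have := Nat.find_spec hex
    rwa [hk'] at this
  set v := w * (A (k' + 1))⁻¹ with hv
  have hlen : wordLength s v + (k' + 1) = wordLength s w := hlt (k' + 1) le_rfl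
  have hlen' := hlt k' (by omega)
  have hvm : v ∈ Subgroup.closure (range s) := hAm (k' + 1)
  have hnext : wordLength s v ≤ wordLength s (v * s (if Even (k' + 1) then j else i)) := by
    have h3 := wordLength_le_mul hs hvm (if Even (k' + 1) then j else i)
    have hbad' : ¬ wordLength s (v * s (if Even (k' + 1) then j else i)) + (k' + 2) =
        wordLength s w := by rwa [hstep (k' + 1)] at hbad
    omega
  have hprev : wordLength s v ≤ wordLength s (v * s (if Even k' then j else i)) := by
    have h2 : v * s (if Even k' then j else i) = w * (A k')⁻¹ := by
      rw [hv, hstep, mul_assoc, hs, mul_one]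
    rw [h2]
    omega
  -- Parity decides which of i, j is the letter just stripped and which is the one that fails to
  -- shorten v.
  have hpos : (∀ k, 0 ≤ b.repr (v (b i)) k) ∧ (∀ k, 0 ≤ b.repr (v (b j)) k) := by
    have hlt' : wordLength s v < wordLength s w := by omega
    by_cases he : Even k'
    · have he' : ¬ Even (k' + 1) := by simpa [Nat.even_add_one] using he
      rw [if_neg he'] at hnext
      rw [if_pos he] at hprev
      exact ⟨fun k => ih _ hlt' hvm k hnext rfl, fun k => ih _ hlt' hvm k hprev rfl⟩
    · have he' : Even (k' + 1) := by simpa [Nat.even_add_one] using he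
      rw [if_pos he'] at hnext
      rw [if_neg he] at hprev
      exact ⟨fun k => ih _ hlt' hvm k hprev rfl, fun k => ih _ hlt' hvm k hnext rfl⟩
  have happ := alternatingProd_apply hB (simpleReflection_apply hΔ i) (simpleReflection_apply hΔ j)
    (hΔ.basis_diag i) (hΔ.basis_diag j)
  have hcoef : 0 ≤ dihedralSeq (-B (b i) (b j)) (k' + 1) ∧
      0 ≤ dihedralSeq (-B (b i) (b j)) (k' + 2) := by
    rcases dihedralSeq_nonneg_or hΔ hij with hd | ⟨m, hm1, hd, hm, hm'⟩
    · exact ⟨hd _, hd _⟩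
    · suffices hkm : k' + 1 < m from ⟨hd _ (by omega), hd _ (by omega)⟩
      -- If m letters or more were stripped, the relation `A (m + 1) * s i = A m` (with m lowered by
      -- one) would make w s_i shorter than w.
      by_contra hkm
      obtain ⟨m, rfl⟩ : ∃ m', m = m' + 1 := ⟨m - 1, by omega⟩
      have e1 := happ (m + 1)
      rw [hm, hm', zero_smul, add_zero, neg_one_smul] at e1
      -- By `e1`, `A (m + 1)` sends α_i to minus the simple root of its own leading letter, so it
      -- conjugates s_i into that letter, which then cancels.
      have e2 : A (m + 1) * s i = A m := by
        have e3 : A (m + 1) * s i = s (if Even m then j else i) * A (m + 1) := by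
          have hinv : ∀ u v', B (A (m + 1) u) (A (m + 1) v') = B u v' :=
            bilin_weylGroup hΔ hB (weylGroup_eq_closure hΔ ▸ alternatingProd_mem s i j (m + 1))
          ext u
          have hz : ∀ z, s (if Even m then j else i) z = z -
              (2 * B (b (if Even m then j else i)) z) • b (if Even m then j else i) :=
            simpleReflection_apply hΔ _
          have e1' : b (if Even m then j else i) = - A (m + 1) (b i) := by
            rw [e1, neg_neg]
            by_cases he : Even m <;> simp [he, Nat.even_add_one]
          rw [LinearEquiv.mul_apply, LinearEquiv.mul_apply, hz, e1',
            simpleReflection_apply hΔ i, map_neg, LinearMap.neg_apply, hinv, map_sub, map_smul]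
          module
        rw [e3, hA, alternatingProd, ← apply_ite s, ← mul_assoc, hs, one_mul]
      obtain ⟨l, hl, hl'⟩ := alternatingProd_eq_prod s i j m
      have e4 := wordLength_mul_prod_le hs (hAm (m + 1)) l
      rw [hl', mul_assoc, ← hA, ← e2, ← mul_assoc _ _ (s i), inv_mul_cancel, one_mul, hl] at e4
      have e5 := hlt (m + 1) (by omega)
      omega
  have hwv : w = v * A (k' + 1) := by rw [hv, inv_mul_cancel_right]
  rw [hwv, LinearEquiv.mul_apply, happ, map_add, map_smul, map_smul, map_add, map_smul, map_smul,
    Finsupp.add_apply, Finsupp.smul_apply, Finsupp.smul_apply, smul_eq_mul, smul_eq_mul]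
  refine add_nonneg (mul_nonneg hcoef.2 ?_) (mul_nonneg hcoef.1 ?_)
  · split_ifs
    exacts [hpos.1 k, hpos.2 k]
  · split_ifs
    exacts [hpos.2 k, hpos.1 k]

/-- The vectors with nonnegative coordinates in the basis `b`. -/
def nonnegCone (b : Module.Basis ι ℝ V) : Set V := {v | ∀ k, 0 ≤ b.repr v k}

theorem basis_mem_nonnegCone (i : ι) : b i ∈ nonnegCone b := by
  classical
  intro k
  rw [b.repr_self, Finsupp.single_apply]
  split_ifs <;> norm_num

theorem weylGroup_apply_basis_or (hΔ : IsSimpleSystem B (range b)) (hB : B.IsSymm) {w : V ≃ₗ[ℝ] V}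
    (hw : w ∈ weylGroup B (range b)) (i : ι) :
    w (b i) ∈ nonnegCone b ∨ -w (b i) ∈ nonnegCone b := by
  rcases le_or_gt (wordLength (simpleReflection hΔ) w)
    (wordLength (simpleReflection hΔ) (w * simpleReflection hΔ i)) with h | h
  · exact .inl (coord_nonneg_of_wordLength_le hΔ hB hw h)
  · right
    have hw' := mul_mem hw (simpleReflection_mem hΔ i)
    have h' : w * simpleReflection hΔ i * simpleReflection hΔ i = w := by
      rw [mul_assoc, simpleReflection_mul_self, mul_one]
    have := coord_nonneg_of_wordLength_le hΔ hB hw' (i := i) (by rw [h']; exact h.le)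
    rwa [LinearEquiv.mul_apply, simpleReflection_self, map_neg] at this

theorem root_or (hΔ : IsSimpleSystem B (range b)) (hB : B.IsSymm) {ρ : V}
    (hρ : ρ ∈ roots B (range b)) :
    ρ ∈ nonnegCone b ∨ -ρ ∈ nonnegCone b := by
  obtain ⟨w, hw, _, ⟨i, rfl⟩, rfl⟩ := hρ
  exact weylGroup_apply_basis_or hΔ hB hw i

/-- A nontrivial w is shortened by some s_i, and then -w(α_i) is nonnegative as well, forcing w(α_i)
= 0. -/
theorem weylGroup_eq_one (hΔ : IsSimpleSystem B (range b)) (hB : B.IsSymm) {w : V ≃ₗ[ℝ] V}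
    (hw : w ∈ weylGroup B (range b)) (h : ∀ i, w (b i) ∈ nonnegCone b) : w = 1 := by
  by_contra h1
  obtain ⟨i, hi⟩ := exists_wordLength_mul_lt (simpleReflection_mul_self hΔ)
    (weylGroup_eq_closure hΔ ▸ hw) h1
  have hw' := mul_mem hw (simpleReflection_mem hΔ i)
  have h' : w * simpleReflection hΔ i * simpleReflection hΔ i = w := by
    rw [mul_assoc, simpleReflection_mul_self, mul_one]
  have h2 := coord_nonneg_of_wordLength_le hΔ hB hw' (i := i) (by rw [h']; exact hi.le)
  rw [LinearEquiv.mul_apply, simpleReflection_self, map_neg, map_neg] at h2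
  have h3 : w (b i) = 0 := by
    refine b.repr.injective (Finsupp.ext fun k => ?_)
    have := h i k
    have := h2 k
    rw [Finsupp.neg_apply] at this
    rw [map_zero, Finsupp.zero_apply]
    linarith
  exact b.ne_zero i (w.injective (h3.trans (map_zero w).symm))

theorem basis_mem_roots (i : ι) : b i ∈ roots B (range b) :=
  ⟨1, one_mem _, b i, ⟨i, rfl⟩, rfl⟩

theorem weylGroup_apply_mem_roots {w : V ≃ₗ[ℝ] V} (hw : w ∈ weylGroup B (range b)) {ρ : V}
    (hρ : ρ ∈ roots B (range b)) : w ρ ∈ roots B (range b) := by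
  obtain ⟨w', hw', α, hα, rfl⟩ := hρ
  exact ⟨w * w', mul_mem hw hw', α, hα, rfl⟩

theorem bilin_root_self (hΔ : IsSimpleSystem B (range b)) (hB : B.IsSymm) {ρ : V}
    (hρ : ρ ∈ roots B (range b)) : B ρ ρ = 1 := by
  obtain ⟨w, hw, _, ⟨i, rfl⟩, rfl⟩ := hρ
  rw [bilin_weylGroup hΔ hB hw, hΔ.basis_diag]

theorem neg_mem_roots (hΔ : IsSimpleSystem B (range b)) {ρ : V}
    (hρ : ρ ∈ roots B (range b)) : -ρ ∈ roots B (range b) := by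
  obtain ⟨w, hw, _, ⟨i, rfl⟩, rfl⟩ := hρ
  refine ⟨w * simpleReflection hΔ i, mul_mem hw (simpleReflection_mem hΔ i), b i, ⟨i, rfl⟩, ?_⟩
  rw [LinearEquiv.mul_apply, simpleReflection_self, map_neg]

/-- The reflection in a root belongs to the group generated by the simple reflections. -/
theorem exists_root_reflection (hΔ : IsSimpleSystem B (range b)) (hB : B.IsSymm) {ρ : V}
    (hρ : ρ ∈ roots B (range b)) :
    ∃ t ∈ weylGroup B (range b), ∀ v, t v = v - (2 * B ρ v) • ρ := by
  obtain ⟨w, hw, _, ⟨i, rfl⟩, rfl⟩ := hρ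
  refine ⟨w * simpleReflection hΔ i * w⁻¹,
    mul_mem (mul_mem hw (simpleReflection_mem hΔ i)) (inv_mem hw), fun v => ?_⟩
  obtain ⟨u, rfl⟩ := w.surjective v
  have h : w⁻¹ (w u) = u := w.symm_apply_apply u
  rw [LinearEquiv.mul_apply, LinearEquiv.mul_apply, h, simpleReflection_apply, map_sub, map_smul,
    bilin_weylGroup hΔ hB hw]

/-- The reflection s_i changes only the i-th coordinate, and a positive root other than α_i has
another positive coordinate, which fixes the sign of its image. -/
theorem simpleReflection_mem_nonnegCone (hB : B.IsSymm) {ρ : V} (hρ : ρ ∈ roots B (range b))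
    (hρ' : ρ ∈ nonnegCone b) {i : ι} (hi : ρ ≠ b i) :
    simpleReflection hΔ i ρ ∈ nonnegCone b := by
  classical
  have hk : ∃ k, k ≠ i ∧ b.repr ρ k ≠ 0 := by
    by_contra! h
    have h1 : ρ = b.repr ρ i • b i := by
      refine b.repr.injective (Finsupp.ext fun k => ?_)
      by_cases hk : k = i
      · subst hk; simp
      · rw [h k hk, map_smul, b.repr_self, Finsupp.smul_apply, Finsupp.single_apply,
          if_neg (Ne.symm hk), smul_zero]
    have h2 := bilin_root_self hΔ hB hρ
    rw [h1, map_smul, map_smul, LinearMap.smul_apply, hΔ.basis_diag, smul_eq_mul, smul_eq_mul,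
      mul_one, mul_self_eq_one_iff] at h2
    rcases h2 with h2 | h2
    · rw [h2, one_smul] at h1; exact hi h1
    · linarith [hρ' i]
  obtain ⟨k, hki, hk⟩ := hk
  have h1 : b.repr (simpleReflection hΔ i ρ) k = b.repr ρ k := by
    rw [simpleReflection_apply, map_sub, map_smul, b.repr_self, Finsupp.sub_apply,
      Finsupp.smul_apply, Finsupp.single_apply, if_neg (Ne.symm hki), smul_zero, sub_zero]
  refine (root_or hΔ hB
    (weylGroup_apply_mem_roots (simpleReflection_mem hΔ i) hρ)).resolve_right fun h => hk ?_
  have h2 := h k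
  rw [map_neg, Finsupp.neg_apply, h1] at h2
  linarith [hρ' k]

end Simple

/-! ### Discreteness of the roots and limits of normalized roots. -/

section Discrete

open Filter

variable {V : Type*} [NormedAddCommGroup V] [NormedSpace ℝ V] {ι : Type*} [Fintype ι]
  {b : Module.Basis ι ℝ V} {B : LinearMap.BilinForm ℝ V}

theorem continuous_bilin (b : Module.Basis ι ℝ V) (B : LinearMap.BilinForm ℝ V) :
    Continuous fun p : V × V => B p.1 p.2 := by
  have : FiniteDimensional ℝ V := b.finiteDimensional_of_finite
  let B' : V →L[ℝ] V →L[ℝ] ℝ :=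
    LinearMap.toContinuousLinearMap (LinearMap.toContinuousLinearMap.toLinearMap ∘ₗ B)
  exact B'.continuous₂

theorem continuous_linear (b : Module.Basis ι ℝ V) {W : Type*} [AddCommGroup W] [Module ℝ W]
    [TopologicalSpace W] [IsTopologicalAddGroup W] [ContinuousSMul ℝ W] (f : V →ₗ[ℝ] W) :
    Continuous f :=
  have : FiniteDimensional ℝ V := b.finiteDimensional_of_finite
  f.continuous_of_finiteDimensional

theorem continuous_coord (b : Module.Basis ι ℝ V) (k : ι) : Continuous fun v => b.repr v k :=
  continuous_linear b (b.coord k)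

theorem continuous_coordSum (b : Module.Basis ι ℝ V) : Continuous (coordSum b) :=
  continuous_finsetSum _ fun k _ => continuous_coord b k

theorem coordSum_add (b : Module.Basis ι ℝ V) (u v : V) :
    coordSum b (u + v) = coordSum b u + coordSum b v := by
  simp [coordSum, Finset.sum_add_distrib]

theorem coordSum_smul (b : Module.Basis ι ℝ V) (c : ℝ) (v : V) :
    coordSum b (c • v) = c * coordSum b v := by
  simp [coordSum, Finset.mul_sum]

theorem coordSum_neg (b : Module.Basis ι ℝ V) (v : V) : coordSum b (-v) = -coordSum b v := by
  simp [coordSum]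

theorem coordSum_sub (b : Module.Basis ι ℝ V) (u v : V) :
    coordSum b (u - v) = coordSum b u - coordSum b v := by
  simp [coordSum]

theorem coordSum_basis (b : Module.Basis ι ℝ V) (i : ι) : coordSum b (b i) = 1 := by
  classical
  simp [coordSum, Finsupp.single_apply]

theorem coordSum_normalize {v : V} (h : coordSum b v ≠ 0) : coordSum b (normalize b v) = 1 := by
  rw [normalize, coordSum_smul, inv_mul_cancel₀ h]

theorem normalize_smul {c : ℝ} (hc : c ≠ 0) (v : V) : normalize b (c • v) = normalize b v := by
  rw [normalize, normalize, coordSum_smul, smul_smul, mul_inv_rev, mul_assoc, inv_mul_cancel₀ hc,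
    mul_one]

theorem normalize_neg (v : V) : normalize b (-v) = normalize b v := by
  rw [← neg_one_smul ℝ v, normalize_smul (by norm_num)]

theorem normalize_eq_self {v : V} (h : coordSum b v = 1) : normalize b v = v := by
  rw [normalize, h, inv_one, one_smul]

theorem continuousAt_normalize {v : V} (h : coordSum b v ≠ 0) :
    ContinuousAt (normalize b) v :=
  ((continuous_coordSum b).continuousAt.inv₀ h).smul continuousAt_id

theorem coordSum_pos {v : V} (hv : v ∈ nonnegCone b) (h0 : v ≠ 0) : 0 < coordSum b v := by
  refine (Finset.sum_nonneg fun k _ => hv k).lt_of_ne fun h => h0 ?_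
  refine b.repr.injective (Finsupp.ext fun k => ?_)
  rw [map_zero, Finsupp.zero_apply]
  exact (Finset.sum_eq_zero_iff_of_nonneg fun k _ => hv k).1 h.symm k (Finset.mem_univ k)

theorem isClosed_nonnegCone (b : Module.Basis ι ℝ V) : IsClosed (nonnegCone b) := by
  rw [nonnegCone, ofPred_forall]
  exact isClosed_iInter fun k => isClosed_le continuous_const (continuous_coord b k)

theorem isCompact_nonnegCone_inter (b : Module.Basis ι ℝ V) (C : ℝ) :
    IsCompact (nonnegCone b ∩ {v | coordSum b v ≤ C}) := by
  have h : IsCompact (b.equivFun.symm '' Icc (0 : ι → ℝ) fun _ => C) :=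
    isCompact_Icc.image (b.equivFun.symm.toLinearMap.continuous_of_finiteDimensional)
  refine h.of_isClosed_subset
    ((isClosed_nonnegCone b).inter (isClosed_le (continuous_coordSum b) continuous_const)) ?_
  rintro v ⟨hv, hvC⟩
  refine ⟨b.equivFun v, ⟨fun k => hv k, fun k => ?_⟩, b.equivFun.symm_apply_apply v⟩
  exact (Finset.single_le_sum (fun k _ => hv k) (Finset.mem_univ k)).trans hvC

variable (hΔ : IsSimpleSystem B (range b)) (hB : B.IsSymm)
include hΔ hB

omit [Fintype ι] in
theorem root_ne_zero {ρ : V} (hρ : ρ ∈ roots B (range b)) : ρ ≠ 0 := by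
  rintro rfl
  have := bilin_root_self hΔ hB hρ
  simp at this

theorem coordSum_root_ne_zero {ρ : V} (hρ : ρ ∈ roots B (range b)) : coordSum b ρ ≠ 0 := by
  have h0 := root_ne_zero hΔ hB hρ
  rcases root_or hΔ hB hρ with h | h
  · exact (coordSum_pos h h0).ne'
  · have := coordSum_pos h (neg_ne_zero.2 h0)
    rw [coordSum_neg] at this
    linarith

omit [Fintype ι] in
theorem mem_nonnegCone_of_coord_pos {ρ : V} (hρ : ρ ∈ roots B (range b)) {k : ι}
    (hk : 0 < b.repr ρ k) : ρ ∈ nonnegCone b := by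
  refine (root_or hΔ hB hρ).resolve_right fun h => ?_
  have := h k
  rw [map_neg, Finsupp.neg_apply] at this
  linarith

/-- The root system has no accumulation point: the product of the reflections in two nearby
roots is close to the identity, hence maps simple roots to positive roots. -/
theorem not_accPt_roots (x : V) : ¬ AccPt x (𝓟 (roots B (range b))) := by
  intro hx
  have hxB : B x x = 1 := by
    have hcl : IsClosed {v | B v v = 1} :=
      isClosed_eq ((continuous_bilin b B).comp (continuous_id.prodMk continuous_id))
        continuous_const
    exact hcl.closure_subset_iff.2 (fun ρ hρ => bilin_root_self hΔ hB hρ)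
      (mem_closure_iff_clusterPt.2 hx.clusterPt)
  have hc := continuous_bilin b B
  have hc1 : Continuous fun p : V × V => B p.1 p.2 := hc
  -- For roots p.1 and p.2 this is the product of their reflections applied to α_i; at (x, x) it
  -- equals α_i because B(x, x) = 1.
  let F : ι → V × V → V := fun i p =>
    (b i - (2 * B p.2 (b i)) • p.2) - (2 * B p.1 (b i - (2 * B p.2 (b i)) • p.2)) • p.1
  have hF : ∀ i, Continuous (F i) := by
    intro i
    have h1 : Continuous fun p : V × V => B p.2 (b i) :=
      hc.comp (continuous_snd.prodMk continuous_const)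
    have h2 : Continuous fun p : V × V => b i - (2 * B p.2 (b i)) • p.2 :=
      continuous_const.sub ((continuous_const.mul h1).smul continuous_snd)
    exact h2.sub ((continuous_const.mul (hc.comp (continuous_fst.prodMk h2))).smul continuous_fst)
  have hFx : ∀ i, F i (x, x) = b i := by
    intro i
    simp only [F, map_sub, map_smul, hxB, smul_eq_mul]
    module
  have hev : ∀ᶠ p in 𝓝 x ×ˢ 𝓝 x, (∀ i, 0 < b.repr (F i p) i) ∧ 0 < B p.1 p.2 := by
    rw [← nhds_prod_eq]
    refine (eventually_all.2 fun i => ?_).and ?_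
    · have : ContinuousAt (fun p => b.repr (F i p) i) (x, x) :=
        ((continuous_coord b i).comp (hF i)).continuousAt
      refine this.eventually (lt_mem_nhds ?_)
      simp [hFx]
    · refine hc.continuousAt.eventually (lt_mem_nhds ?_)
      simp [hxB]
  obtain ⟨U, hU, hUF⟩ := mem_prod_same_iff.1 hev
  obtain ⟨ρ, ⟨hρU, hρ⟩, -⟩ := accPt_iff_nhds.1 hx U hU
  obtain ⟨ρ', hρ', hne⟩ : ∃ ρ' ∈ U ∩ roots B (range b), ρ' ≠ ρ := by
    by_cases h : ρ = x
    · subst h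
      exact accPt_iff_nhds.1 hx U hU
    · obtain ⟨ρ', ⟨⟨h1, h2⟩, h3⟩, -⟩ :=
        accPt_iff_nhds.1 hx (U ∩ {ρ}ᶜ) (inter_mem hU (compl_singleton_mem_nhds (Ne.symm h)))
      exact ⟨ρ', ⟨h1, h3⟩, h2⟩
  obtain ⟨hpos, hcpos⟩ := hUF (mk_mem_prod hρU hρ'.1)
  obtain ⟨t, ht, hta⟩ := exists_root_reflection hΔ hB hρ
  obtain ⟨t', ht', hta'⟩ := exists_root_reflection hΔ hB hρ'.2
  have hw : t * t' = 1 := by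
    refine weylGroup_eq_one hΔ hB (mul_mem ht ht') fun i => ?_
    refine mem_nonnegCone_of_coord_pos hΔ hB
      (weylGroup_apply_mem_roots (mul_mem ht ht') (basis_mem_roots i)) (k := i) ?_
    have h := hpos i
    rwa [LinearEquiv.mul_apply, hta, hta']
  -- The two reflections coincide, so the roots are proportional, hence equal up to sign; positivity
  -- of B(ρ, ρ') excludes the minus sign.
  have h1 : ρ' = B ρ ρ' • ρ := by
    have h2 : t (t' ρ') = ρ' := by rw [← LinearEquiv.mul_apply, hw]; rfl
    have h3 : t' ρ' = -ρ' := by rw [hta', bilin_root_self hΔ hB hρ'.2]; module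
    have h4 : (2 : ℝ) • ρ' = (2 : ℝ) • (B ρ ρ' • ρ) := by
      rw [h3, hta, map_neg] at h2
      nth_rewrite 1 [two_smul]
      nth_rewrite 1 [← h2]
      module
    exact smul_right_injective V (two_ne_zero (α := ℝ)) h4
  have h2 := bilin_root_self hΔ hB hρ'.2
  rw [h1, map_smul, map_smul, LinearMap.smul_apply, bilin_root_self hΔ hB hρ, smul_eq_mul,
    smul_eq_mul, mul_one, mul_self_eq_one_iff] at h2
  simp only at hcpos
  rcases h2 with h2 | h2
  · rw [h2, one_smul] at h1; exact hne h1
  · linarith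

theorem finite_roots_inter {K : Set V} (hK : IsCompact K) : (roots B (range b) ∩ K).Finite := by
  by_contra h
  obtain ⟨x, -, hx⟩ := Set.Infinite.exists_accPt_of_subset_isCompact h hK inter_subset_right
  exact not_accPt_roots hΔ hB x (hx.mono (principal_mono.2 inter_subset_left))

/-- Nonnegative vectors of bounded coordinate sum form a compact set, which contains finitely many
roots. -/
theorem tendsto_coordSum_posRoots :
    Tendsto (coordSum b) (cofinite ⊓ 𝓟 (roots B (range b) ∩ nonnegCone b)) atTop := by
  rw [tendsto_atTop]
  intro C
  rw [eventually_inf_principal, eventually_cofinite]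
  refine (finite_roots_inter hΔ hB (isCompact_nonnegCone_inter b C)).subset fun ρ hρ => ?_
  simp only [mem_ofPred_eq, not_forall, not_le] at hρ
  obtain ⟨⟨h1, h2⟩, h3⟩ := hρ
  exact ⟨h1, h2, h3.le⟩

theorem bilin_normalize {ρ : V} (hρ : ρ ∈ roots B (range b)) :
    B (normalize b ρ) (normalize b ρ) = (coordSum b ρ)⁻¹ ^ 2 := by
  rw [normalize, map_smul, map_smul, LinearMap.smul_apply, bilin_root_self hΔ hB hρ, smul_eq_mul,
    smul_eq_mul, mul_one, sq]

theorem normalize_root_mem_nonnegCone {ρ : V} (hρ : ρ ∈ roots B (range b)) :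
    normalize b ρ ∈ nonnegCone b := by
  have key : ∀ σ : V, σ ∈ nonnegCone b → normalize b σ ∈ nonnegCone b := fun σ hσ k => by
    rw [normalize, map_smul, Finsupp.smul_apply, smul_eq_mul]
    exact mul_nonneg (inv_nonneg.2 (Finset.sum_nonneg fun k _ => hσ k)) (hσ k)
  rcases root_or hΔ hB hρ with h | h
  · exact key ρ h
  · rw [← normalize_neg]; exact key _ h

/-- A limit point of the normalizations of positive roots of unbounded size is isotropic. -/
theorem bilin_limit_eq_zero {F : Filter V} [F.NeBot]
    (hF : F ≤ cofinite ⊓ 𝓟 (roots B (range b) ∩ nonnegCone b)) {y : V}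
    (hy : Tendsto (normalize b) F (𝓝 y)) : B y y = 0 := by
  have h1 : Tendsto (fun ρ => B (normalize b ρ) (normalize b ρ)) F (𝓝 (B y y)) :=
    ((continuous_bilin b B).tendsto (y, y)).comp (hy.prodMk_nhds hy)
  have h2 : Tendsto (fun ρ => (coordSum b ρ)⁻¹ ^ 2) F (𝓝 0) := by
    have := (tendsto_inv_atTop_zero.comp ((tendsto_coordSum_posRoots hΔ hB).mono_left hF)).pow 2
    simpa using this
  refine tendsto_nhds_unique (h1.congr' ?_) h2
  filter_upwards [hF (mem_inf_of_right (mem_principal_self _))] with ρ hρ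
  exact bilin_normalize hΔ hB hρ.1

theorem coordSum_limit {F : Filter V} [F.NeBot]
    (hF : F ≤ cofinite ⊓ 𝓟 (roots B (range b) ∩ nonnegCone b)) {y : V}
    (hy : Tendsto (normalize b) F (𝓝 y)) : coordSum b y = 1 := by
  refine tendsto_nhds_unique (((continuous_coordSum b).tendsto y).comp hy)
    (tendsto_const_nhds.congr' ?_)
  filter_upwards [hF (mem_inf_of_right (mem_principal_self _))] with ρ hρ
  exact (coordSum_normalize (coordSum_root_ne_zero hΔ hB hρ.1)).symm

theorem limit_mem_nonnegCone {F : Filter V} [F.NeBot]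
    (hF : F ≤ cofinite ⊓ 𝓟 (roots B (range b) ∩ nonnegCone b)) {y : V}
    (hy : Tendsto (normalize b) F (𝓝 y)) : y ∈ nonnegCone b := by
  refine (isClosed_nonnegCone b).mem_of_tendsto hy ?_
  filter_upwards [hF (mem_inf_of_right (mem_principal_self _))] with ρ hρ
  exact normalize_root_mem_nonnegCone hΔ hB hρ.1

theorem exists_limit {T : Set V} (hT : T.Infinite)
    (hTr : T ⊆ roots B (range b) ∩ nonnegCone b) :
    ∃ (F : Filter V) (y : V), F.NeBot ∧ F ≤ cofinite ⊓ 𝓟 T ∧ Tendsto (normalize b) F (𝓝 y) := by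
  have : (cofinite ⊓ 𝓟 T).NeBot := cofinite_inf_principal_neBot_iff.2 hT
  let F : Ultrafilter V := Ultrafilter.of (cofinite ⊓ 𝓟 T)
  have hF : (F : Filter V) ≤ cofinite ⊓ 𝓟 T := Ultrafilter.of_le _
  have hK : (F.map (normalize b) : Filter V) ≤ 𝓟 (nonnegCone b ∩ {v | coordSum b v ≤ 1}) := by
    rw [Ultrafilter.coe_map, le_principal_iff, mem_map]
    filter_upwards [hF (mem_inf_of_right (mem_principal_self _))] with ρ hρ
    exact ⟨normalize_root_mem_nonnegCone hΔ hB (hTr hρ).1,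
      (coordSum_normalize (coordSum_root_ne_zero hΔ hB (hTr hρ).1)).le⟩
  obtain ⟨y, -, hy⟩ := (isCompact_nonnegCone_inter b 1).ultrafilter_le_nhds _ hK
  exact ⟨F, y, F.neBot, hF, hy⟩

/-- Each neighbourhood of η contains infinitely many normalized roots, hence comes from infinitely
many positive roots, because ρ and -ρ have the same normalization. -/
theorem exists_filter_of_mem_limitRoots {η : V} (hη : η ∈ limitRoots B b) :
    ∃ F : Filter V, F.NeBot ∧ F ≤ cofinite ⊓ 𝓟 (roots B (range b) ∩ nonnegCone b) ∧
      Tendsto (normalize b) F (𝓝 η) := by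
  refine ⟨comap (normalize b) (𝓝 η) ⊓ (cofinite ⊓ 𝓟 (roots B (range b) ∩ nonnegCone b)), ?_,
    inf_le_right, tendsto_comap.mono_left inf_le_left⟩
  refine inf_neBot_iff_frequently_left.2 fun {p} hp => ?_
  obtain ⟨U, hU, hUp⟩ := mem_comap.1 hp
  rw [frequently_inf_principal, frequently_cofinite_iff_infinite]
  intro hfin
  have h1 : AccPt η (𝓟 (U ∩ normRoots B b)) := AccPt.nhds_inter hη hU
  have h2 : (U ∩ normRoots B b).Finite := by
    refine (hfin.image (normalize b)).subset ?_
    rintro _ ⟨hxU, ρ, hρ, rfl⟩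
    rcases root_or hΔ hB hρ with h | h
    · exact ⟨ρ, ⟨⟨hρ, h⟩, hUp hxU⟩, rfl⟩
    · refine ⟨-ρ, ⟨⟨neg_mem_roots hΔ hρ, h⟩, hUp ?_⟩, normalize_neg ρ⟩
      rwa [mem_preimage, normalize_neg]
  obtain ⟨y, hy, hyη⟩ := accPt_iff_nhds.1 h1 _
    ((h2.subset sdiff_subset).isClosed.isOpen_compl.mem_nhds (x := η)
      (s := ((U ∩ normRoots B b) \ {η})ᶜ) (by simp))
  exact hy.1 ⟨hy.2, hyη⟩

end Discrete

/-! ### Isotropic points on lines through two roots are limit roots. -/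

section DihedralLimit

open Filter

variable {V : Type*} [NormedAddCommGroup V] [NormedSpace ℝ V] {ι : Type*} [Fintype ι]
  {b : Module.Basis ι ℝ V} {B : LinearMap.BilinForm ℝ V}

/-- The numbers t and t⁻¹ are the roots of the characteristic polynomial x² - 2ax + 1. Dividing by
the n-th term shows that successive ratios tend to t when t ≥ 1, the double root t = 1 included. -/
theorem dihedralSeq_succ_sub {a t : ℝ} (ht : t ≠ 0) (h : t + t⁻¹ = 2 * a) (n : ℕ) :
    dihedralSeq a (n + 1) = t * dihedralSeq a n + t⁻¹ ^ n := by
  induction n with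
  | zero => simp [dihedralSeq]
  | succ n ih =>
    have h1 : t⁻¹ * t = 1 := inv_mul_cancel₀ ht
    rw [dihedralSeq, ← h, pow_succ]
    linear_combination (t⁻¹) * ih + dihedralSeq a n * h1

theorem tendsto_dihedralSeq_ratio {a t : ℝ} (ht : 1 ≤ t) (h : t + t⁻¹ = 2 * a) :
    Tendsto (fun n => dihedralSeq a (n + 1) / dihedralSeq a n) atTop (𝓝 t) := by
  have ht0 : 0 < t := by linarith
  have ha : 1 ≤ a := by
    have : t * t⁻¹ = 1 := mul_inv_cancel₀ ht0.ne'
    nlinarith [sq_nonneg (t - t⁻¹), inv_pos.2 ht0]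
  have h0 : Tendsto (fun n => t⁻¹ ^ n / dihedralSeq a n) atTop (𝓝 0) := by
    refine squeeze_zero' (Eventually.of_forall fun n => ?_) (Eventually.of_forall fun n => ?_)
      tendsto_inv_atTop_nhds_zero_nat
    · have := natCast_le_dihedralSeq ha n
      have : 0 ≤ dihedralSeq a n := n.cast_nonneg.trans this
      positivity
    · rcases Nat.eq_zero_or_pos n with rfl | hn
      · simp [dihedralSeq]
      · have hn' : (0 : ℝ) < n := by exact_mod_cast hn
        have h1 : t⁻¹ ^ n ≤ 1 := pow_le_one₀ (by positivity) (inv_le_one_of_one_le₀ ht)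
        rw [← one_div (n : ℝ)]
        exact div_le_div₀ zero_le_one h1 hn' (natCast_le_dihedralSeq ha n)
  have h1 : Tendsto (fun n => t + t⁻¹ ^ n / dihedralSeq a n) atTop (𝓝 t) := by
    simpa using h0.const_add t
  refine h1.congr' ?_
  filter_upwards [eventually_gt_atTop 0] with n hn
  have hn' : (0 : ℝ) < n := by exact_mod_cast hn
  have hpos : 0 < dihedralSeq a n := hn'.trans_le (natCast_le_dihedralSeq ha n)
  rw [dihedralSeq_succ_sub ht0.ne' h, add_div, mul_div_cancel_right₀ _ hpos.ne']

variable (hΔ : IsSimpleSystem B (range b)) (hB : B.IsSymm)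
include hΔ hB

omit [Fintype ι] in
theorem dihedral_mem_roots {σ τ : V} (hσ : σ ∈ roots B (range b)) (hτ : τ ∈ roots B (range b))
    (n : ℕ) : dihedralSeq (-B σ τ) (2 * n + 1) • σ + dihedralSeq (-B σ τ) (2 * n) • τ ∈
      roots B (range b) := by
  obtain ⟨x, hx, hxa⟩ := exists_root_reflection hΔ hB hσ
  obtain ⟨y, hy, hya⟩ := exists_root_reflection hΔ hB hτ
  have h := alternatingProd_apply hB hxa hya (bilin_root_self hΔ hB hσ)
    (bilin_root_self hΔ hB hτ) (2 * n)
  rw [if_pos (even_two_mul n), if_pos (even_two_mul n)] at h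
  rw [← h]
  refine weylGroup_apply_mem_roots ?_ hσ
  generalize 2 * n = m
  induction m with
  | zero => exact one_mem _
  | succ m ih =>
    rw [alternatingProd]
    refine mul_mem ?_ ih
    split_ifs
    exacts [hy, hx]

theorem isotropic_mem_limitRoots_of_one_le {σ τ : V} (hσ : σ ∈ roots B (range b))
    (hτ : τ ∈ roots B (range b)) {t : ℝ} (ht : 1 ≤ t) (h : t + t⁻¹ = 2 * -B σ τ)
    (hsum : coordSum b (t • σ + τ) ≠ 0) : normalize b (t • σ + τ) ∈ limitRoots B b := by
  set a := -B σ τ with ha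
  have ht0 : t ≠ 0 := by positivity
  set x := normalize b (t • σ + τ) with hx
  have hxB : B x x = 0 := by
    have hs : B τ σ = B σ τ := hB.eq _ _
    have h1 : t * t⁻¹ = 1 := mul_inv_cancel₀ ht0
    have : B (t • σ + τ) (t • σ + τ) = 0 := by
      simp only [map_add, map_smul, LinearMap.add_apply, LinearMap.smul_apply, smul_eq_mul, hs,
        bilin_root_self hΔ hB hσ, bilin_root_self hΔ hB hτ]
      linear_combination t * h - h1
    rw [hx, normalize, map_smul, map_smul, LinearMap.smul_apply, this, smul_zero, smul_zero]
  have h3 : Tendsto (fun n : ℕ => 2 * n) atTop atTop :=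
    tendsto_atTop_mono (fun n => Nat.le_mul_of_pos_left n two_pos) tendsto_id
  have hlim : Tendsto (fun n => normalize b
      ((dihedralSeq a (2 * n + 1) / dihedralSeq a (2 * n)) • σ + τ)) atTop (𝓝 x) := by
    refine (continuousAt_normalize hsum).tendsto.comp ?_
    exact (((tendsto_dihedralSeq_ratio ht h).comp h3).smul_const σ).add_const τ
  refine accPt_iff_frequently.2 (hlim.frequently (Eventually.frequently ?_))
  filter_upwards [eventually_gt_atTop 0] with n hn
  have hn' : (0 : ℝ) < ((2 * n : ℕ) : ℝ) := by exact_mod_cast (by omega : 0 < 2 * n)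
  have ha1 : 1 ≤ a := by
    have : t * t⁻¹ = 1 := mul_inv_cancel₀ ht0
    nlinarith [sq_nonneg (t - t⁻¹), inv_pos.2 (zero_lt_one.trans_le ht)]
  have hpos : 0 < dihedralSeq a (2 * n) := hn'.trans_le (natCast_le_dihedralSeq ha1 _)
  have hr := dihedral_mem_roots hΔ hB hσ hτ n
  have heq : normalize b ((dihedralSeq a (2 * n + 1) / dihedralSeq a (2 * n)) • σ + τ) =
      normalize b (dihedralSeq a (2 * n + 1) • σ + dihedralSeq a (2 * n) • τ) := by
    rw [← normalize_smul hpos.ne', smul_add, smul_smul, mul_div_cancel₀ _ hpos.ne']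
  rw [heq]
  -- An approximating normalized root differs from the limit because it is not isotropic.
  refine ⟨fun e => ?_, _, hr, rfl⟩
  have h4 := bilin_normalize hΔ hB hr
  rw [← ha, e, hxB] at h4
  exact pow_ne_zero 2 (inv_ne_zero (coordSum_root_ne_zero hΔ hB hr)) h4.symm

/-- Isotropy says that t = p / q satisfies t + t⁻¹ = -2B(σ, τ). Replacing τ by -τ makes t positive,
and exchanging the two roots makes t ≥ 1. -/
theorem isotropic_mem_limitRoots {σ τ : V} (hσ : σ ∈ roots B (range b))
    (hτ : τ ∈ roots B (range b)) {p q : ℝ} (h : B (p • σ + q • τ) (p • σ + q • τ) = 0)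
    (hsum : coordSum b (p • σ + q • τ) = 1) : p • σ + q • τ ∈ limitRoots B b := by
  have hs : B τ σ = B σ τ := hB.eq _ _
  have key : p * p + q * q + 2 * p * q * B σ τ = 0 := by
    simp only [map_add, map_smul, LinearMap.add_apply, LinearMap.smul_apply, smul_eq_mul, hs,
      bilin_root_self hΔ hB hσ, bilin_root_self hΔ hB hτ] at h
    linarith
  have hp : p ≠ 0 := by
    rintro rfl
    have : q = 0 := by simpa using key
    subst this
    simp [coordSum] at hsum
  have hq : q ≠ 0 := by
    rintro rfl
    exact hp (by simpa using key)
  wlog hpq : 0 < p * q generalizing q τ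
  · have h1 := this (τ := -τ) (q := -q) (neg_mem_roots hΔ hτ)
    rw [smul_neg, neg_smul, neg_neg] at h1
    refine h1 h hsum (by rw [map_neg, LinearMap.neg_apply, hs, map_neg])
      (by rw [map_neg]; linarith) (neg_ne_zero.2 hq) ?_
    have := lt_of_le_of_ne (not_lt.1 hpq) (mul_ne_zero hp hq)
    linarith
  have main : ∀ (σ τ : V) (p q : ℝ), σ ∈ roots B (range b) → τ ∈ roots B (range b) → p ≠ 0 →
      q ≠ 0 → p * p + q * q + 2 * p * q * B σ τ = 0 → 1 ≤ p / q →
      coordSum b (p • σ + q • τ) = 1 → p • σ + q • τ ∈ limitRoots B b := by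
    intro σ τ p q hσ hτ hp hq key hpq hsum
    have e1 : p • σ + q • τ = q • ((p / q) • σ + τ) := by
      rw [smul_add, smul_smul, mul_div_cancel₀ _ hq]
    have h0 : coordSum b ((p / q) • σ + τ) ≠ 0 := by
      rintro h0
      rw [e1, coordSum_smul, h0, mul_zero] at hsum
      exact zero_ne_one hsum
    rw [← normalize_eq_self hsum, e1, normalize_smul hq]
    refine isotropic_mem_limitRoots_of_one_le hΔ hB hσ hτ hpq ?_ h0
    field_simp
    linarith
  have hpq' : 0 < p / q := by
    rw [div_eq_mul_inv]
    rcases pos_and_pos_or_neg_and_neg_of_mul_pos hpq with ⟨h1, h2⟩ | ⟨h1, h2⟩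
    · exact mul_pos h1 (inv_pos.2 h2)
    · exact mul_pos_of_neg_of_neg h1 (inv_lt_zero.2 h2)
  rcases le_total 1 (p / q) with h1 | h1
  · exact main σ τ p q hσ hτ hp hq key h1 hsum
  · rw [add_comm] at hsum ⊢
    refine main τ σ q p hτ hσ hq hp (by rw [hs]; linarith) ?_ hsum
    rw [← inv_div]
    exact (one_le_inv₀ hpq').2 h1

theorem simpleDihedralLimitRoots_subset :
    simpleDihedralLimitRoots B b ⊆ limitRoots B b := by
  intro x hx
  simp only [simpleDihedralLimitRoots, mem_iUnion] at hx
  obtain ⟨_, ⟨i, rfl⟩, ρ, ⟨hρ, -⟩, hxL, hxQ, hx1⟩ := hx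
  obtain ⟨r, rfl⟩ := mem_affineSpan_pair_iff_exists_lineMap_eq.1 hxL
  have e : AffineMap.lineMap (b i) (normalize b ρ) r =
      (1 - r) • b i + (r * (coordSum b ρ)⁻¹) • ρ := by
    rw [AffineMap.lineMap_apply_module, normalize, smul_smul]
  rw [e] at hxQ hx1 ⊢
  exact isotropic_mem_limitRoots hΔ hB (basis_mem_roots i) hρ hxQ hx1

end DihedralLimit

/-! ### Density: the transversal case, then the affine case. -/

section Density

open Filter

variable {V : Type*} [NormedAddCommGroup V] [NormedSpace ℝ V] {ι : Type*} [Fintype ι]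
  {b : Module.Basis ι ℝ V} {B : LinearMap.BilinForm ℝ V}

theorem mem_posRoots {ρ : V} (hρ : ρ ∈ roots B (range b)) (h : ρ ∈ nonnegCone b) :
    ρ ∈ posRoots B (range b) := by
  refine ⟨hρ, ?_⟩
  rw [← b.sum_repr ρ]
  refine Submodule.sum_mem _ fun k _ => ?_
  exact Submodule.smul_mem _ (⟨b.repr ρ k, h k⟩ : NNReal) (PointedCone.subset_hull ⟨k, rfl⟩)

/-- If `B (b i) η ≠ 0`, then the line through `b i` and a normalized root close to `η` meets the
isotropic cone close to `η`. -/
theorem mem_closure_of_bilin_ne_zero (hΔ : IsSimpleSystem B (range b)) (hB : B.IsSymm)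
    {F : Filter V} [F.NeBot]
    (hF : F ≤ cofinite ⊓ 𝓟 (roots B (range b) ∩ nonnegCone b)) {η : V}
    (hη : Tendsto (normalize b) F (𝓝 η)) {i : ι} (hi : B (b i) η ≠ 0) :
    η ∈ closure (simpleDihedralLimitRoots B b) := by
  set c₀ := B (b i) η with hc₀
  obtain ⟨s, hs1, hs2⟩ : ∃ s : ℝ, s * s = 1 ∧ s * |c₀| = c₀ := by
    rcases abs_cases c₀ with ⟨h, -⟩ | ⟨h, -⟩
    · exact ⟨1, by norm_num, by rw [h, one_mul]⟩
    · exact ⟨-1, by norm_num, by rw [h]; ring⟩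
  have hQ : B η η = 0 := bilin_limit_eq_zero hΔ hB hF hη
  let e : V → ℝ := fun y => B y y
  let c : V → ℝ := fun y => B (b i) y
  let r : V → ℝ := fun y => (c y - e y) ^ 2 - (1 - 2 * c y + e y) * e y
  -- Isotropy of y + t(α_i - y) reads e + 2t(c - e) + t²(1 - 2c + e) = 0. The root tending to 0 is t
  -- = -e / q, in rationalized form, so the leading coefficient may vanish. The sign s of c₀ gives
  -- q(η) = 2c₀ ≠ 0.
  let q : V → ℝ := fun y => c y - e y + s * √(r y)
  let z : V → V := fun y => y + (-e y / q y) • (b i - y)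
  have he : Continuous e := (continuous_bilin b B).comp (continuous_id.prodMk continuous_id)
  have hc : Continuous c := continuous_linear b (B (b i))
  have hr : Continuous r := by fun_prop
  have hq : Continuous q := by fun_prop
  have hr0 : r η = c₀ ^ 2 := by simp [r, e, c, hQ, hc₀]
  have hq0 : q η ≠ 0 := by
    have : q η = 2 * c₀ := by
      simp only [q, hr0, Real.sqrt_sq_eq_abs, hs2]
      simp only [e, c, hQ]
      ring
    rw [this]
    exact mul_ne_zero two_ne_zero hi
  have hz : Tendsto z (𝓝 η) (𝓝 η) := by
    have h1 : ContinuousAt z η :=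
      continuousAt_id.add ((he.continuousAt.neg.div hq.continuousAt hq0).smul
        (continuousAt_const.sub continuousAt_id))
    have h2 : z η = η := by simp [z, e, hQ]
    have h3 := h1.tendsto
    rwa [h2] at h3
  have hgood : ∀ᶠ y in 𝓝 η, B (z y) (z y) = 0 := by
    have h1 : ∀ᶠ y in 𝓝 η, 0 < r y := hr.continuousAt.eventually
      (lt_mem_nhds (by rw [hr0]; positivity))
    have h2 : ∀ᶠ y in 𝓝 η, q y ≠ 0 := hq.continuousAt.eventually_ne hq0
    filter_upwards [h1, h2] with y hy1 hy2
    have h3 : √(r y) * √(r y) = r y := Real.mul_self_sqrt hy1.le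
    have h4 : q y * q y - 2 * (c y - e y) * q y + (1 - 2 * c y + e y) * e y = 0 := by
      have h5 : q y = c y - e y + s * √(r y) := rfl
      have h6 : r y = (c y - e y) ^ 2 - (1 - 2 * c y + e y) * e y := rfl
      rw [h5]
      linear_combination (√(r y) * √(r y)) * hs1 + h3 + h6
    have hsy : B y (b i) = c y := hB.eq _ _
    have hyy : B y y = e y := rfl
    have hyc : B (b i) y = c y := rfl
    have h5 : -e y / q y * q y = -e y := div_mul_cancel₀ _ hy2
    set t := -e y / q y with ht
    have h6 : B (z y) (z y) = e y + 2 * t * (c y - e y) + t * t * (1 - 2 * c y + e y) := by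
      have : z y = y + t • (b i - y) := rfl
      rw [this]
      simp only [map_add, map_sub, map_smul, LinearMap.add_apply, LinearMap.sub_apply,
        LinearMap.smul_apply, smul_eq_mul, hΔ.basis_diag, hsy, hyy, hyc]
      ring
    have h7 : (e y + 2 * t * (c y - e y) + t * t * (1 - 2 * c y + e y)) * (q y * q y) = 0 := by
      linear_combination (2 * (c y - e y) * q y + (t * q y - e y) * (1 - 2 * c y + e y)) * h5 +
        e y * h4
    rw [h6]
    exact (mul_eq_zero.1 h7).resolve_right (mul_ne_zero hy2 hy2)
  refine mem_closure_of_tendsto (hz.comp hη) ?_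
  filter_upwards [hη.eventually hgood, hF (mem_inf_of_right (mem_principal_self _))] with ρ h1 h2
  simp only [simpleDihedralLimitRoots, mem_iUnion]
  refine ⟨b i, ⟨i, rfl⟩, ρ, mem_posRoots h2.1 h2.2, ?_, h1, ?_⟩
  · refine mem_affineSpan_pair_iff_exists_lineMap_rev_eq.2
      ⟨-e (normalize b ρ) / q (normalize b ρ), ?_⟩
    rw [AffineMap.lineMap_apply, vsub_eq_sub, vadd_eq_add, add_comm]
    rfl
  · change coordSum b (normalize b ρ + _ • (b i - normalize b ρ)) = 1
    rw [coordSum_add, coordSum_smul, coordSum_sub,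
      coordSum_normalize (coordSum_root_ne_zero hΔ hB h2.1), coordSum_basis]
    ring

/-- The span of the simple roots with index in `S`. -/
def supportedOn (b : Module.Basis ι ℝ V) (S : Set ι) : Submodule ℝ V where
  carrier := {v | ∀ k ∉ S, b.repr v k = 0}
  add_mem' hu hv k hk := by rw [map_add, Finsupp.add_apply, hu k hk, hv k hk, add_zero]
  zero_mem' k _ := by rw [map_zero, Finsupp.zero_apply]
  smul_mem' c v hv k hk := by rw [map_smul, Finsupp.smul_apply, hv k hk, smul_zero]

omit [Fintype ι] in
theorem basis_mem_supportedOn {S : Set ι} {i : ι} (hi : i ∈ S) : b i ∈ supportedOn b S := by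
  classical
  intro k hk
  rw [b.repr_self, Finsupp.single_apply, if_neg]
  rintro rfl
  exact hk hi

theorem bilin_basis_left (b : Module.Basis ι ℝ V) (B : LinearMap.BilinForm ℝ V) (u v : V) :
    B u v = ∑ j, b.repr v j * B u (b j) := by
  conv_lhs => rw [← b.sum_repr v]
  simp only [map_sum, map_smul, smul_eq_mul]

theorem bilin_eq_zero_of_supportedOn {S : Set ι} {u v : V} (h : ∀ j ∈ S, B u (b j) = 0)
    (hv : v ∈ supportedOn b S) : B u v = 0 := by
  rw [bilin_basis_left b]
  refine Finset.sum_eq_zero fun j _ => ?_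
  by_cases hj : j ∈ S
  · rw [h j hj, mul_zero]
  · rw [hv j hj, zero_mul]

theorem isClosed_submodule (b : Module.Basis ι ℝ V) (U : Submodule ℝ V) :
    IsClosed (U : Set V) :=
  have : FiniteDimensional ℝ V := b.finiteDimensional_of_finite
  U.closed_of_finiteDimensional

section Orthogonal

variable (hΔ : IsSimpleSystem B (range b)) (hB : B.IsSymm) {S : Set ι}
  (hS : ∀ i ∈ S, ∀ j ∉ S, B (b i) (b j) = 0)
include hΔ hB hS

/-- Simple reflections indexed by S preserve the span, and the others fix it pointwise. -/
theorem weylGroup_supportedOn {w : V ≃ₗ[ℝ] V} (hw : w ∈ weylGroup B (range b)) {v : V}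
    (hv : v ∈ supportedOn b S) : w v ∈ supportedOn b S := by
  refine weylGroup_induction hΔ (p := fun w => w v ∈ supportedOn b S) hv (fun i w h => ?_) hw
  rw [LinearEquiv.mul_apply, simpleReflection_apply]
  by_cases hi : i ∈ S
  · exact sub_mem h (Submodule.smul_mem _ _ (basis_mem_supportedOn hi))
  · rw [bilin_eq_zero_of_supportedOn (fun j hj => (hB.eq _ _).trans (hS j hj i hi)) h]
    simpa using h

theorem root_supportedOn_or {ρ : V} (hρ : ρ ∈ roots B (range b)) :
    ρ ∈ supportedOn b S ∨ ρ ∈ supportedOn b Sᶜ := by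
  obtain ⟨w, hw, _, ⟨i, rfl⟩, rfl⟩ := hρ
  by_cases hi : i ∈ S
  · exact .inl (weylGroup_supportedOn hΔ hB hS hw (basis_mem_supportedOn hi))
  · refine .inr (weylGroup_supportedOn hΔ hB (fun j hj k hk => ?_) hw (basis_mem_supportedOn hi))
    exact (hB.eq _ _).trans (hS k (not_not.1 hk) j hj)

end Orthogonal

/-- Only finitely many roots lie in a subspace on which `B` is positive definite. -/
theorem finite_roots_inter_of_posDef (hΔ : IsSimpleSystem B (range b)) (hB : B.IsSymm)
    (U : Submodule ℝ V) (hU : ∀ v ∈ U, B v v = 0 → v = 0) :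
    (roots B (range b) ∩ U).Finite := by
  have h : (roots B (range b) ∩ nonnegCone b ∩ U).Finite := by
    by_contra h
    obtain ⟨F, y, hne, hF, hy⟩ := exists_limit hΔ hB h inter_subset_left
    have hF' : F ≤ cofinite ⊓ 𝓟 (roots B (range b) ∩ nonnegCone b) :=
      hF.trans (inf_le_inf_left _ (principal_mono.2 inter_subset_left))
    have hyU : y ∈ U := by
      refine (isClosed_submodule b U).mem_of_tendsto hy ?_
      filter_upwards [hF (mem_inf_of_right (mem_principal_self _))] with ρ hρ
      exact U.smul_mem _ hρ.2
    have h1 := coordSum_limit hΔ hB hF' hy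
    rw [hU y hyU (bilin_limit_eq_zero hΔ hB hF' hy)] at h1
    simp [coordSum] at h1
  refine (h.union (h.image fun v => -v)).subset ?_
  rintro ρ ⟨hρ, hρU⟩
  rcases root_or hΔ hB hρ with h | h
  · exact .inl ⟨⟨hρ, h⟩, hρU⟩
  · exact .inr ⟨-ρ, ⟨⟨neg_mem_roots hΔ hρ, h⟩, U.neg_mem hρU⟩, neg_neg ρ⟩

/-- The indices of the nonzero coordinates. -/
def coordSupport (b : Module.Basis ι ℝ V) (v : V) : Set ι := {k | b.repr v k ≠ 0}

/-- A nonnegative radical vector of coordinate sum `1` with connected support: the data attached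
to an irreducible affine component. -/
structure IsAffineRadical (B : LinearMap.BilinForm ℝ V) (b : Module.Basis ι ℝ V) (η : V) :
    Prop where
  nonneg : η ∈ nonnegCone b
  coordSum_eq : coordSum b η = 1
  bilin_eq : ∀ v, B v η = 0
  connected : ∀ S : Set ι, ∀ i ∈ S, i ∈ coordSupport b η → ∀ j ∉ S, j ∈ coordSupport b η →
    ∃ i ∈ S ∩ coordSupport b η, ∃ j ∈ coordSupport b η \ S, B (b i) (b j) ≠ 0

/-- For j outside the support, B(α_j, η) = 0 is a sum of nonpositive terms, so each term vanishes.
-/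
theorem bilin_eq_zero_of_mem_coordSupport (hΔ : IsSimpleSystem B (range b)) (hB : B.IsSymm)
    {η : V} (h0 : η ∈ nonnegCone b) (hrad : ∀ v, B v η = 0) :
    ∀ i ∈ coordSupport b η, ∀ j ∉ coordSupport b η, B (b i) (b j) = 0 := by
  intro i hi j hj
  have hj0 : b.repr η j = 0 := not_not.1 hj
  have h := hrad (b j)
  rw [bilin_basis_left b, Finset.sum_eq_zero_iff_of_nonpos] at h
  · have := (mul_eq_zero.1 (h i (Finset.mem_univ i))).resolve_left hi
    rwa [hB.eq] at this
  · intro k _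
    by_cases hk : j = k
    · rw [← hk, hj0, zero_mul]
    · exact mul_nonpos_of_nonneg_of_nonpos (h0 k) (hΔ.basis_offDiag_nonpos hk)

/-- If the support split into two orthogonal parts, each root would vanish on one of them, yet roots
whose normalization is near η are nonzero at any two chosen indices of the support. -/
theorem isAffineRadical_of_limit (hΔ : IsSimpleSystem B (range b)) (hB : B.IsSymm)
    {F : Filter V} [F.NeBot]
    (hF : F ≤ cofinite ⊓ 𝓟 (roots B (range b) ∩ nonnegCone b)) {η : V}
    (hη : Tendsto (normalize b) F (𝓝 η)) (hrad : ∀ i, B (b i) η = 0) :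
    IsAffineRadical B b η := by
  have h0 := limit_mem_nonnegCone hΔ hB hF hη
  have hr : ∀ v, B v η = 0 := fun v => by
    have : B v η = B η v := hB.eq _ _
    rw [this, bilin_basis_left b]
    refine Finset.sum_eq_zero fun j _ => ?_
    have : B η (b j) = B (b j) η := hB.eq _ _
    rw [this, hrad, mul_zero]
  refine ⟨h0, coordSum_limit hΔ hB hF hη, hr, ?_⟩
  intro S i hiS hi j hjS hj
  by_contra! hcon
  have horth := bilin_eq_zero_of_mem_coordSupport hΔ hB h0 hr
  have hS : ∀ i ∈ S ∩ coordSupport b η, ∀ j ∉ S ∩ coordSupport b η, B (b i) (b j) = 0 := by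
    intro i hi j hj
    by_cases hjI : j ∈ coordSupport b η
    · exact hcon i hi j ⟨hjI, fun h => hj ⟨h, hjI⟩⟩
    · exact horth i hi.2 j hjI
  have hcoord : ∀ k ∈ coordSupport b η, ∀ᶠ ρ in F, b.repr ρ k ≠ 0 := fun k hk => by
    have h1 : Tendsto (fun ρ => b.repr (normalize b ρ) k) F (𝓝 (b.repr η k)) :=
      ((continuous_coord b k).tendsto η).comp hη
    filter_upwards [h1.eventually_ne hk] with ρ hρ h
    refine hρ ?_
    rw [normalize, map_smul, Finsupp.smul_apply, h, smul_zero]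
  obtain ⟨ρ, hρi, hρj, hρ⟩ := ((hcoord i hi).and ((hcoord j hj).and
    (hF (mem_inf_of_right (mem_principal_self _))))).exists
  rcases root_supportedOn_or hΔ hB hS hρ.1 with h | h
  · exact hρj (h j fun h' => hjS h'.1)
  · exact hρi (h i fun h' => h' ⟨hiS, hi⟩)

/-! ### Roots of an irreducible affine component. -/

namespace IsAffineRadical

variable {η : V} (H : IsAffineRadical B b η) (hΔ : IsSimpleSystem B (range b)) (hB : B.IsSymm)
include H

theorem ne_zero : η ≠ 0 := by
  rintro rfl
  have := H.coordSum_eq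
  simp [coordSum] at this

theorem simpleReflection_apply_eq (i : ι) : simpleReflection hΔ i η = η := by
  rw [simpleReflection_apply, H.bilin_eq]; simp

include hΔ hB

/-- On the span of the support of `η`, the form is positive semidefinite with kernel `ℝ η`. -/
theorem eq_smul_of_bilin_eq_zero {v : V} (hv : v ∈ supportedOn b (coordSupport b η))
    (h : B v v = 0) : ∃ c : ℝ, v = c • η := by
  set x : ι → ℝ := fun k => b.repr v k / b.repr η k with hx
  have hvx : ∀ k, b.repr v k = x k * b.repr η k := fun k => by
    by_cases hk : b.repr η k = 0
    · rw [hk, mul_zero]; exact hv k fun h => h hk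
    · exact (div_mul_cancel₀ _ hk).symm
  have hrow : ∀ i, ∑ j, b.repr η j * B (b i) (b j) = 0 := fun i => by
    rw [← bilin_basis_left b]; exact H.bilin_eq _
  have hcol : ∀ j, ∑ i, b.repr η i * B (b i) (b j) = 0 := fun j => by
    rw [← hrow j]
    exact Finset.sum_congr rfl fun i _ => by rw [hB.eq]
  have hvv : ∑ i, ∑ j, b.repr η i * b.repr η j * B (b i) (b j) * (x i * x j) = 0 := by
    have h1 : B v v = ∑ j, b.repr v j * ∑ i, b.repr v i * B (b j) (b i) := by
      rw [bilin_basis_left b]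
      refine Finset.sum_congr rfl fun j _ => ?_
      have : B v (b j) = B (b j) v := hB.eq _ _
      rw [this, bilin_basis_left b (v := v)]
    rw [← h, h1]
    refine Finset.sum_congr rfl fun i _ => ?_
    rw [Finset.mul_sum]
    refine Finset.sum_congr rfl fun j _ => ?_
    rw [hvx, hvx]
    ring
  -- Since η is in the radical, the square terms drop out and this sum is -2B(v, v). All its terms
  -- are nonpositive, so x agrees across every nonzero B(α_i, α_j) in the support, and connectedness
  -- makes it constant there.
  have hsq : ∑ i, ∑ j, b.repr η i * b.repr η j * B (b i) (b j) * (x i - x j) ^ 2 = 0 := by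
    have e1 : ∑ i, ∑ j, b.repr η i * b.repr η j * B (b i) (b j) * x i ^ 2 = 0 := by
      refine Finset.sum_eq_zero fun i _ => ?_
      rw [← mul_zero (b.repr η i * x i ^ 2), ← hrow i, Finset.mul_sum]
      exact Finset.sum_congr rfl fun j _ => by ring
    have e2 : ∑ i, ∑ j, b.repr η i * b.repr η j * B (b i) (b j) * x j ^ 2 = 0 := by
      rw [Finset.sum_comm]
      refine Finset.sum_eq_zero fun j _ => ?_
      rw [← mul_zero (b.repr η j * x j ^ 2), ← hcol j, Finset.mul_sum]
      exact Finset.sum_congr rfl fun i _ => by ring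
    have e3 : ∑ i, ∑ j, b.repr η i * b.repr η j * B (b i) (b j) * (x i - x j) ^ 2 =
        ∑ i, ∑ j, b.repr η i * b.repr η j * B (b i) (b j) * x i ^ 2 +
        ∑ i, ∑ j, b.repr η i * b.repr η j * B (b i) (b j) * x j ^ 2 -
        2 * ∑ i, ∑ j, b.repr η i * b.repr η j * B (b i) (b j) * (x i * x j) := by
      simp only [Finset.mul_sum, ← Finset.sum_add_distrib, ← Finset.sum_sub_distrib]
      exact Finset.sum_congr rfl fun i _ => Finset.sum_congr rfl fun j _ => by ring
    rw [e3, e1, e2, hvv]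
    ring
  have hterm : ∀ i j, b.repr η i * b.repr η j * B (b i) (b j) * (x i - x j) ^ 2 ≤ 0 := by
    intro i j
    by_cases hij : i = j
    · rw [hij, sub_self]; simp
    · exact mul_nonpos_of_nonpos_of_nonneg (mul_nonpos_of_nonneg_of_nonpos
        (mul_nonneg (H.nonneg i) (H.nonneg j)) (hΔ.basis_offDiag_nonpos hij)) (sq_nonneg _)
  have hzero : ∀ i j, b.repr η i * b.repr η j * B (b i) (b j) * (x i - x j) ^ 2 = 0 := by
    intro i j
    have h1 := (Finset.sum_eq_zero_iff_of_nonpos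
      fun i _ => Finset.sum_nonpos fun j _ => hterm i j).1 hsq i (Finset.mem_univ i)
    exact (Finset.sum_eq_zero_iff_of_nonpos fun j _ => hterm i j).1 h1 j (Finset.mem_univ j)
  obtain ⟨i₀, hi₀⟩ : ∃ i, b.repr η i ≠ 0 := by
    by_contra! h0
    exact H.ne_zero (b.repr.injective (Finsupp.ext fun k => by simp [h0 k]))
  refine ⟨x i₀, b.repr.injective (Finsupp.ext fun k => ?_)⟩
  rw [map_smul, Finsupp.smul_apply, smul_eq_mul, hvx]
  by_cases hk : b.repr η k = 0
  · rw [hk, mul_zero, mul_zero]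
  · by_contra hne
    have hxk : k ∉ {j | x j = x i₀} := fun h => hne (by rw [show x k = x i₀ from h])
    obtain ⟨i, ⟨hi, hiη⟩, j, ⟨hjη, hj⟩, hij⟩ := H.connected {j | x j = x i₀} i₀ rfl hi₀ k hxk hk
    have h1 := (mul_eq_zero.1 (hzero i j)).resolve_left (mul_ne_zero (mul_ne_zero hiη hjη) hij)
    have h2 : x i = x j := sub_eq_zero.1 (pow_eq_zero_iff two_ne_zero |>.1 h1)
    exact hj (h2.symm.trans hi)

/-- The hyperplane of vanishing i-th coordinate does not contain η, so it avoids the isotropic line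
ℝη. -/
theorem finite_roots_coord_eq_zero {i : ι} (hi : i ∈ coordSupport b η) :
    (roots B (range b) ∩ (supportedOn b (coordSupport b η) ⊓ LinearMap.ker (b.coord i) :
      Submodule ℝ V)).Finite := by
  refine finite_roots_inter_of_posDef hΔ hB _ fun v hv h => ?_
  obtain ⟨c, rfl⟩ := H.eq_smul_of_bilin_eq_zero hΔ hB hv.1 h
  have h1 : b.repr (c • η) i = 0 := hv.2
  rw [map_smul, Finsupp.smul_apply, smul_eq_mul] at h1
  rw [(mul_eq_zero.1 h1).resolve_right hi, zero_smul]

/-- The normalizations of infinitely many such roots would accumulate at η, where f is positive. -/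
theorem finite_posRoots_nonpos {f : V →ₗ[ℝ] ℝ} (hf : f η = 1) :
    {ρ | ρ ∈ roots B (range b) ∧ ρ ∈ nonnegCone b ∧ ρ ∈ supportedOn b (coordSupport b η) ∧
      f ρ < 0}.Finite := by
  by_contra h
  obtain ⟨F, y, hne, hF, hy⟩ := exists_limit hΔ hB h fun ρ hρ => ⟨hρ.1, hρ.2.1⟩
  have hF' : F ≤ cofinite ⊓ 𝓟 (roots B (range b) ∩ nonnegCone b) :=
    hF.trans (inf_le_inf_left _ (principal_mono.2 fun ρ hρ => ⟨hρ.1, hρ.2.1⟩))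
  have hFT := hF (mem_inf_of_right (mem_principal_self _))
  have hyU : y ∈ supportedOn b (coordSupport b η) := by
    refine (isClosed_submodule b _).mem_of_tendsto hy ?_
    filter_upwards [hFT] with ρ hρ
    exact Submodule.smul_mem _ _ hρ.2.2.1
  obtain ⟨c, rfl⟩ := H.eq_smul_of_bilin_eq_zero hΔ hB hyU (bilin_limit_eq_zero hΔ hB hF' hy)
  have h1 := coordSum_limit hΔ hB hF' hy
  rw [coordSum_smul, H.coordSum_eq, mul_one] at h1
  have h2 : f (c • η) ≤ 0 := by
    refine le_of_tendsto (((continuous_linear b f).tendsto _).comp hy) ?_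
    filter_upwards [hFT] with ρ hρ
    have h3 := coordSum_pos hρ.2.1 (root_ne_zero hΔ hB hρ.1)
    simp only [Function.comp, normalize, map_smul, smul_eq_mul]
    exact mul_nonpos_of_nonneg_of_nonpos (inv_nonneg.2 h3.le) hρ.2.2.2.le
  rw [map_smul, hf, h1] at h2
  norm_num at h2

/-- A functional positive on `η` is conjugate to one that is nonnegative on the simple roots of
the support. -/
theorem exists_dominant {f : V →ₗ[ℝ] ℝ} (hf : f η = 1) :
    ∃ w ∈ weylGroup B (range b), f (w η) = 1 ∧ ∀ i ∈ coordSupport b η, 0 ≤ f (w (b i)) := by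
  have horth := bilin_eq_zero_of_mem_coordSupport hΔ hB H.nonneg H.bilin_eq
  set N : (V →ₗ[ℝ] ℝ) → Set V := fun f => {ρ | ρ ∈ roots B (range b) ∧ ρ ∈ nonnegCone b ∧
    ρ ∈ supportedOn b (coordSupport b η) ∧ f ρ < 0} with hN
  induction hn : (N f).ncard using Nat.strong_induction_on generalizing f with
  | _ n ih =>
  subst hn
  by_cases hdom : ∀ i ∈ coordSupport b η, 0 ≤ f (b i)
  · exact ⟨1, one_mem _, hf, hdom⟩
  push Not at hdom
  obtain ⟨i, hi, hneg⟩ := hdom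
  set s := simpleReflection hΔ i with hs
  have hss : ∀ v, s (s v) = v := fun v => by
    rw [← LinearEquiv.mul_apply, simpleReflection_mul_self]; rfl
  have hfs : (f ∘ₗ s.toLinearMap) η = 1 := by
    change f (s η) = 1
    rw [H.simpleReflection_apply_eq hΔ, hf]
  -- The reflection s permutes the positive roots other than α_i, and α_i itself stops being
  -- negative, so the number of negative values drops.
  have hsub : N (f ∘ₗ s.toLinearMap) ⊆ s '' (N f \ {b i}) := by
    rintro ρ ⟨h1, h2, h3, h4⟩
    have h4' : f (s ρ) < 0 := h4
    have hne : ρ ≠ b i := by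
      rintro rfl
      rw [simpleReflection_self, map_neg] at h4'
      linarith
    refine ⟨s ρ, ⟨⟨weylGroup_apply_mem_roots (simpleReflection_mem hΔ i) h1,
      simpleReflection_mem_nonnegCone hΔ hB h1 h2 hne,
      weylGroup_supportedOn hΔ hB horth (simpleReflection_mem hΔ i) h3, h4'⟩, ?_⟩, hss ρ⟩
    intro h5
    have h6 : ρ = -b i := by
      rw [← hss ρ, show s ρ = b i from h5, simpleReflection_self]
    have h7 := h2 i
    rw [h6] at h7
    simp at h7
    linarith
  have hmem : b i ∈ N f :=
    ⟨basis_mem_roots i, basis_mem_nonnegCone i, basis_mem_supportedOn hi, hneg⟩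
  have hfin : (N f).Finite := H.finite_posRoots_nonpos hΔ hB hf
  have hlt : (N (f ∘ₗ s.toLinearMap)).ncard < (N f).ncard := by
    calc (N (f ∘ₗ s.toLinearMap)).ncard ≤ (s '' (N f \ {b i})).ncard :=
          ncard_le_ncard hsub ((hfin.subset sdiff_subset).image _)
      _ ≤ (N f \ {b i}).ncard := ncard_image_le (hfin.subset sdiff_subset)
      _ < (N f).ncard := ncard_sdiff_singleton_lt_of_mem hmem hfin
  obtain ⟨w, hw, hwη, hwd⟩ := ih _ hlt hfs rfl
  exact ⟨s * w, mul_mem (simpleReflection_mem hΔ i) hw, hwη, hwd⟩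

/-- The products of two roots of the affine component take finitely many values. -/
theorem exists_finite_bilin_values : ∃ Z : Set ℝ, Z.Finite ∧
    ∀ ρ ∈ roots B (range b), ρ ∈ supportedOn b (coordSupport b η) →
    ∀ σ ∈ roots B (range b), σ ∈ supportedOn b (coordSupport b η) → B ρ σ ∈ Z := by
  have horth := bilin_eq_zero_of_mem_coordSupport hΔ hB H.nonneg H.bilin_eq
  let K : ι → Set V := fun i => roots B (range b) ∩
    (supportedOn b (coordSupport b η) ⊓ LinearMap.ker (b.coord i) : Submodule ℝ V)
  refine ⟨{1, -1} ∪ ⋃ i ∈ coordSupport b η, image2 (fun u v => B u v) (K i) (K i), ?_, ?_⟩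
  · refine (toFinite _).union ((toFinite _).biUnion fun i hi => ?_)
    exact (H.finite_roots_coord_eq_zero hΔ hB hi).image2 _
      (H.finite_roots_coord_eq_zero hΔ hB hi)
  intro ρ hρ hρI σ hσ hσI
  -- If the plane of ρ and σ contains η, then B degenerates on it and B(ρ, σ) = ±1. Otherwise some f
  -- with f(η) = 1 kills both roots; once made dominant by w, it forces w⁻¹ρ and w⁻¹σ to have a
  -- common vanishing coordinate, which leaves finitely many choices.
  by_cases hspan : η ∈ Submodule.span ℝ {ρ, σ}
  · left
    obtain ⟨p, q, hpq⟩ := Submodule.mem_span_pair.1 hspan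
    have hs : B σ ρ = B ρ σ := hB.eq _ _
    have h1 := H.bilin_eq ρ
    have h2 := H.bilin_eq σ
    rw [← hpq] at h1 h2
    simp only [map_add, map_smul, smul_eq_mul, bilin_root_self hΔ hB hρ,
      bilin_root_self hΔ hB hσ, hs, mul_one] at h1 h2
    have h3 : q * (1 - B ρ σ * B ρ σ) = 0 := by linear_combination h2 - B ρ σ * h1
    rcases mul_eq_zero.1 h3 with h4 | h4
    · subst h4
      have hp : p = 0 := by linarith
      subst hp
      exact absurd (by simpa using hpq.symm) H.ne_zero
    · have : B ρ σ * B ρ σ = 1 := by linarith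
      simpa using mul_self_eq_one_iff.1 this
  · right
    obtain ⟨f₀, hf₀, hf₀'⟩ := Submodule.exists_dual_map_eq_bot_of_notMem hspan inferInstance
    have hker : ∀ u ∈ Submodule.span ℝ {ρ, σ}, f₀ u = 0 := fun u hu => by
      have : f₀ u ∈ (Submodule.span ℝ {ρ, σ}).map f₀ := ⟨u, hu, rfl⟩
      rwa [hf₀', Submodule.mem_bot] at this
    obtain ⟨w, hw, hwη, hwd⟩ := H.exists_dominant hΔ hB (f := (f₀ η)⁻¹ • f₀)
      (by simp [hf₀])
    set f : V →ₗ[ℝ] ℝ := (f₀ η)⁻¹ • f₀ with hf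
    have hfρ : f ρ = 0 := by
      rw [hf, LinearMap.smul_apply, hker ρ (Submodule.subset_span (by simp)), smul_zero]
    have hfσ : f σ = 0 := by
      rw [hf, LinearMap.smul_apply, hker σ (Submodule.subset_span (by simp)), smul_zero]
    have hexp : ∀ v, f (w v) = ∑ k, b.repr v k * f (w (b k)) := fun v => by
      conv_lhs => rw [← b.sum_repr v]
      simp only [map_sum, map_smul, smul_eq_mul]
    obtain ⟨i, hi, hipos⟩ : ∃ i ∈ coordSupport b η, 0 < f (w (b i)) := by
      by_contra! hcon
      rw [hexp, Finset.sum_eq_zero] at hwη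
      · exact zero_ne_one hwη
      · intro k _
        by_cases hk : k ∈ coordSupport b η
        · rw [le_antisymm (hcon k hk) (hwd k hk), mul_zero]
        · rw [show b.repr η k = 0 from not_not.1 hk, zero_mul]
    have key : ∀ τ ∈ roots B (range b), τ ∈ supportedOn b (coordSupport b η) → f τ = 0 →
        w⁻¹ τ ∈ K i := by
      intro τ hτ hτI hfτ
      have hI := weylGroup_supportedOn hΔ hB horth (inv_mem hw) hτI
      have hr := weylGroup_apply_mem_roots (inv_mem hw) hτ
      refine ⟨hr, hI, ?_⟩
      have hpos : ∀ v ∈ supportedOn b (coordSupport b η), v ∈ nonnegCone b → f (w v) = 0 →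
          b.repr v i = 0 := by
        intro v hvI hv hfv
        rw [hexp, Finset.sum_eq_zero_iff_of_nonneg] at hfv
        · exact (mul_eq_zero.1 (hfv i (Finset.mem_univ i))).resolve_right hipos.ne'
        · intro k _
          by_cases hk : k ∈ coordSupport b η
          · exact mul_nonneg (hv k) (hwd k hk)
          · rw [hvI k hk, zero_mul]
      have hww : w (w⁻¹ τ) = τ := w.apply_symm_apply τ
      change b.repr (w⁻¹ τ) i = 0
      rcases root_or hΔ hB hr with h | h
      · exact hpos _ hI h (by rw [hww, hfτ])
      · have := hpos _ (neg_mem hI) h (by rw [map_neg, hww, map_neg, hfτ, neg_zero])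
        simpa using this
    refine mem_iUnion₂.2 ⟨i, hi, w⁻¹ ρ, key ρ hρ hρI hfρ, w⁻¹ σ, key σ hσ hσI hfσ, ?_⟩
    exact bilin_weylGroup hΔ hB (inv_mem hw) _ _

/-- If the affine component has infinitely many positive roots, then `η` lies on a line through a
simple root and a normalized positive root. -/
theorem mem_simpleDihedralLimitRoots
    (hinf : (roots B (range b) ∩ nonnegCone b ∩ supportedOn b (coordSupport b η)).Infinite) :
    η ∈ simpleDihedralLimitRoots B b := by
  have horth := bilin_eq_zero_of_mem_coordSupport hΔ hB H.nonneg H.bilin_eq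
  obtain ⟨Z, hZ, hZB⟩ := H.exists_finite_bilin_values hΔ hB
  -- Only finitely many vectors of products with the simple roots can occur, so two distinct
  -- positive roots share the same one and their difference is a multiple of η.
  have hmaps : MapsTo (fun (ρ : V) (i : ι) => B (b i) ρ)
      (roots B (range b) ∩ nonnegCone b ∩ supportedOn b (coordSupport b η))
      (Set.pi univ fun _ => insert 0 Z) := by
    rintro ρ ⟨⟨hρ, -⟩, hρI⟩ i -
    by_cases hi : i ∈ coordSupport b η
    · exact .inr (hZB _ (basis_mem_roots i) (basis_mem_supportedOn hi) ρ hρ hρI)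
    · exact .inl (bilin_eq_zero_of_supportedOn
        (fun j hj => (hB.eq _ _).trans (horth j hj i hi)) hρI)
  obtain ⟨ρ, ⟨⟨hρ, hρ0⟩, hρI⟩, σ, ⟨⟨hσ, hσ0⟩, hσI⟩, hne, heq⟩ :=
    hinf.exists_ne_map_eq_of_mapsTo hmaps (Finite.pi fun _ => hZ.insert 0)
  have hdiff : B (ρ - σ) (ρ - σ) = 0 := by
    rw [bilin_basis_left b]
    refine Finset.sum_eq_zero fun j _ => ?_
    have h1 : B (ρ - σ) (b j) = B (b j) (ρ - σ) := hB.eq _ _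
    have h2 : B (b j) ρ = B (b j) σ := congrFun heq j
    have h3 : B (b j) (ρ - σ) = 0 := by rw [map_sub, h2, sub_self]
    rw [h1, h3, mul_zero]
  obtain ⟨c, hc⟩ := H.eq_smul_of_bilin_eq_zero hΔ hB (sub_mem hρI hσI) hdiff
  have hc0 : c ≠ 0 := by
    rintro rfl
    rw [zero_smul, sub_eq_zero] at hc
    exact hne hc
  obtain ⟨w, hw, _, ⟨j, rfl⟩, rfl⟩ := hρ
  have hwη : w⁻¹ η = η := by
    refine weylGroup_induction hΔ (p := fun w => w η = η) rfl (fun i w h => ?_) (inv_mem hw)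
    rw [LinearEquiv.mul_apply, h, H.simpleReflection_apply_eq hΔ]
  set τ := w⁻¹ σ with hτ
  have hτr : τ ∈ roots B (range b) := weylGroup_apply_mem_roots (inv_mem hw) hσ
  have hτe : τ = b j - c • η := by
    have h1 : σ = w (b j) - c • η := by rw [← hc]; abel
    have h2 : w⁻¹ (w (b j)) = b j := w.symm_apply_apply _
    rw [hτ, h1, map_sub, map_smul, hwη, h2]
  have hsum : coordSum b τ = 1 - c := by
    rw [hτe, coordSum_sub, coordSum_smul, coordSum_basis, H.coordSum_eq, mul_one]
  have hc1 : 1 - c ≠ 0 := by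
    rw [← hsum]; exact coordSum_root_ne_zero hΔ hB hτr
  obtain ⟨τ', hτ'p, hτ'n⟩ : ∃ τ' ∈ posRoots B (range b), normalize b τ' = normalize b τ := by
    rcases root_or hΔ hB hτr with h | h
    · exact ⟨τ, mem_posRoots hτr h, rfl⟩
    · exact ⟨-τ, mem_posRoots (neg_mem_roots hΔ hτr) h, normalize_neg τ⟩
  simp only [simpleDihedralLimitRoots, mem_iUnion]
  refine ⟨b j, ⟨j, rfl⟩, τ', hτ'p, ?_, H.bilin_eq η, H.coordSum_eq⟩
  rw [hτ'n]
  -- The parameter comes from η = (α_j - τ) / c together with |τ|₁ = 1 - c.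
  refine mem_affineSpan_pair_iff_exists_lineMap_eq.2 ⟨-(1 - c) / c, ?_⟩
  rw [AffineMap.lineMap_apply_module, normalize, hsum, hτe]
  have e1 : 1 - -(1 - c) / c = c⁻¹ := by field_simp; ring
  have e2 : -(1 - c) / c * (1 - c)⁻¹ = -c⁻¹ := by field_simp
  rw [e1, smul_smul, e2, smul_sub, smul_smul, neg_mul, inv_mul_cancel₀ hc0]
  module

end IsAffineRadical

theorem limitRoots_subset_closure (hΔ : IsSimpleSystem B (range b)) (hB : B.IsSymm) :
    limitRoots B b ⊆ closure (simpleDihedralLimitRoots B b) := by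
  intro η hη
  obtain ⟨F, hne, hF, hlim⟩ := exists_filter_of_mem_limitRoots hΔ hB hη
  by_cases hrad : ∀ i, B (b i) η = 0
  · have H := isAffineRadical_of_limit hΔ hB hF hlim hrad
    -- Roots whose normalization is near η have a nonzero coordinate in the support, hence lie in
    -- the component; a filter finer than the cofinite one cannot concentrate on finitely many of
    -- them.
    refine subset_closure (H.mem_simpleDihedralLimitRoots hΔ hB fun hfin => ?_)
    obtain ⟨i, hi⟩ : ∃ i, b.repr η i ≠ 0 := by
      by_contra! h0
      exact H.ne_zero (b.repr.injective (Finsupp.ext fun k => by simp [h0 k]))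
    have h1 : ∀ᶠ ρ in F, b.repr (normalize b ρ) i ≠ 0 :=
      (((continuous_coord b i).tendsto η).comp hlim).eventually_ne hi
    have h2 : ∀ᶠ ρ in F, ρ ∉ roots B (range b) ∩ nonnegCone b ∩
        supportedOn b (coordSupport b η) :=
      hF (mem_inf_of_left hfin.compl_mem_cofinite)
    obtain ⟨ρ, h3, h4, h5⟩ :=
      (h1.and (h2.and (hF (mem_inf_of_right (mem_principal_self _))))).exists
    rcases root_supportedOn_or hΔ hB
      (bilin_eq_zero_of_mem_coordSupport hΔ hB H.nonneg H.bilin_eq) h5.1 with h | h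
    · exact h4 ⟨h5, h⟩
    · exact h3 (Submodule.smul_mem _ _ h i fun h' => h' hi)
  · push Not at hrad
    obtain ⟨i, hi⟩ := hrad
    exact mem_closure_of_bilin_ne_zero hΔ hB hF hlim hi

end Density

end BasedRoot

theorem mainTheorem2 {V : Type*} [NormedAddCommGroup V] [NormedSpace ℝ V]
    {ι : Type*} [Fintype ι] (b : Module.Basis ι ℝ V)
    (B : LinearMap.BilinForm ℝ V) (hB : B.IsSymm)
    (hΔ : BasedRoot.IsSimpleSystem B (Set.range b))
    (hinf : (BasedRoot.roots B (Set.range b)).Infinite) :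
    BasedRoot.simpleDihedralLimitRoots B b ⊆ BasedRoot.limitRoots B b ∧
      BasedRoot.limitRoots B b ⊆ closure (BasedRoot.simpleDihedralLimitRoots B b) :=
  ⟨BasedRoot.simpleDihedralLimitRoots_subset hΔ hB, BasedRoot.limitRoots_subset_closure hΔ hB⟩
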